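/- Let $r\ge 0$, $0\le T\le 1$, $\Lambda=\tanh r$, and consider two bosonic modes $A,B$ with Fock basis $|m,n\rangle$. Let $$|\psi_{ps}^{(T)}\rangle=\sum_{n=0}^{\infty}c_n|n,n\rangle,\qquad c_n=\frac{(n+1)(T\Lambda)^n(1-T^2\Lambda^2)^{3/2}}{\sqrt{1+T^2\Lambda^2}},$$ be the photon-subtracted state. This series converges and $\psi_{ps}^{(T)}$ is a unit vector. For a pure two-mode state $\psi$ with Wigner function $W$ and angles $\theta,\varphi\in\mathbb R$, let $W(x_A^\theta,x_B^\varphi)$ be the marginal of $W$ obtained by integrating over $p_A^\theta,p_B^\varphi$, where $x^\theta=x\cos\theta-p\sin\theta$ and $p^\theta=x\sin\theta+p\cos\theta$ in each mode (with $\varphi$ in place of $\theta$ for mode $B$), and put $$E^{\theta,\varphi}_{A,B}(\psi)=\iint \mathrm{sgn}(x_A^\theta x_B^\varphi)\,W(x_A^\theta,x_B^\varphi)\,dx_A^\theta\,dx_B^\varphi,\qquad Q(\psi)=\sup_{\theta,\varphi}|E^{\theta,\varphi}_{A,B}(\psi)|.$$ Let $N(\rho)=\tfrac12(\|\rho^{T_B}\|_1-1)$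 denote the negativity, where $\rho^{T_B}$ is the partial transpose in the Fock basis with respect to mode $B$ and $\|\cdot\|_1$ is the trace norm. Then the Wigner function of $\psi_{ps}^{(T)}$ is integrable, the supremum defining $Q(\psi_{ps}^{(T)})$ is finite, and $$Q(\psi_{ps}^{(T)})=\sum_{n>m\ge 0}\frac{2^{m+n+3}\,\pi\,[F(m,n)-F(n,m)]^2\,c_mc_n}{(m-n)^2\,m!\,n!},\qquad F(m,n)=\frac{1}{\Gamma(-\frac m2)\,\Gamma(\frac{1-n}2)},$$ where the series converges and $1/\Gamma$ is understood as $0$ at the poles of $\Gamma$. Moreover, the partial transpose of $|\psi_{ps}^{(T)}\rangle\langle\psi_{ps}^{(T)}|$ is of trace class, and $$N(\psi_{ps}^{(T)})=\frac{2}{1-T\Lambda}-\frac{1}{1+T^2\Lambda^2}-1 .$$ -/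

import Mathlib

open MeasureTheory

namespace BitCorr

noncomputable section

/-! ### Two bosonic modes: Fock representation and position representation -/

/-- The Hilbert space of two bosonic modes `A`, `B`: square-summable amplitudes in the Fock basis
`|m,n⟩` (`m` photons in mode `A`, `n` photons in mode `B`). -/
abbrev TwoMode : Type := lp (fun _ : ℕ × ℕ => ℂ) 2

/-- The Fock state `|m,n⟩`. -/
def ket (m n : ℕ) : TwoMode := lp.single 2 (m, n) (1 : ℂ)

/-- The normalized Hermite function `h_n(x) = H_n(x) exp(-x²/2) / √(2ⁿ n! √π)`, the position wave
function of the `n`-photon state. Mathlib's `Polynomial.hermite` is the probabilists'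
polynomial `He_n`, and `H_n(x) = 2^(n/2) He_n(√2 x)`. -/
def hermiteFun (n : ℕ) (x : ℝ) : ℝ :=
  Polynomial.aeval (√2 * x) (Polynomial.hermite n) * Real.exp (-x ^ 2 / 2) /
    √((n.factorial : ℝ) * √Real.pi)

/-- The position wave function `h_m(x_A) h_n(x_B)` of `|m,n⟩`. -/
def fockWave (m n : ℕ) (q : ℝ × ℝ) : ℂ := ((hermiteFun m q.1 * hermiteFun n q.2 : ℝ) : ℂ)

theorem integrable_poly_mul_exp (p : Polynomial ℝ) :
    Integrable (fun x : ℝ => p.eval x * Real.exp (-x ^ 2)) := by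
  induction p using Polynomial.induction_on' with
  | add p q hp hq =>
    have h := hp.add hq
    refine h.congr (Filter.Eventually.of_forall fun x => ?_)
    simp [add_mul]
  | monomial k a =>
    have h := integrable_rpow_mul_exp_neg_mul_sq (b := 1) one_pos
      (s := (k : ℝ)) (lt_of_lt_of_le (by norm_num) (Nat.cast_nonneg k))
    refine (h.const_mul a).congr (Filter.Eventually.of_forall fun x => ?_)
    simp [mul_assoc]

theorem continuous_hermiteFun (n : ℕ) : Continuous (hermiteFun n) := by
  unfold hermiteFun
  simp only [Polynomial.aeval_def, Polynomial.eval₂_eq_eval_map]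
  fun_prop

theorem integrable_hermiteFun_sq (n : ℕ) : Integrable (fun x : ℝ => hermiteFun n x ^ 2) := by
  let P : Polynomial ℝ := ((Polynomial.hermite n).map (Int.castRingHom ℝ)).comp
    (Polynomial.C (√2) * Polynomial.X)
  have h := (integrable_poly_mul_exp (P ^ 2)).const_mul
    ((√((n.factorial : ℝ) * √Real.pi) ^ 2)⁻¹)
  refine h.congr (Filter.Eventually.of_forall fun x => ?_)
  have he : Real.exp (-x ^ 2) = Real.exp (-x ^ 2 / 2) ^ 2 := by
    rw [← Real.exp_nat_mul]; congr 1; push_cast; ring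
  have hP : P.eval x = Polynomial.aeval (√2 * x) (Polynomial.hermite n) := by
    simp [P, Polynomial.aeval_def, Polynomial.eval₂_eq_eval_map]
  simp only [hermiteFun, Polynomial.eval_pow, he, hP]
  ring

theorem memLp_fockWave (m n : ℕ) : MemLp (fockWave m n) 2 (volume : Measure (ℝ × ℝ)) := by
  have hc : Continuous (fockWave m n) := by
    have h1 := continuous_hermiteFun m
    have h2 := continuous_hermiteFun n
    unfold fockWave
    fun_prop
  rw [memLp_two_iff_integrable_sq_norm hc.aestronglyMeasurable]
  have h := (integrable_hermiteFun_sq m).mul_prod (integrable_hermiteFun_sq n)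
  refine h.congr (Filter.Eventually.of_forall fun q => ?_)
  simp only [fockWave, Complex.norm_real, Real.norm_eq_abs, sq_abs]
  ring

/-- `|m,n⟩` as an element of `L²(ℝ²)`. -/
def fockL2 (m n : ℕ) : Lp ℂ 2 (volume : Measure (ℝ × ℝ)) := (memLp_fockWave m n).toLp

/-- The position wave function of a state vector, `Ψ = ∑ ψ_{mn} h_m ⊗ h_n`, as an
`L²(ℝ²)`-convergent series. -/
def waveFunction (ψ : TwoMode) : Lp ℂ 2 (volume : Measure (ℝ × ℝ)) :=
  ∑' p : ℕ × ℕ, ψ p • fockL2 p.1 p.2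

/-! ### Wigner function and bit quadrature correlations -/

/-- The Wigner function of the pure state `ψ`, with `[x, p] = i`:
`π⁻² ∫∫ conj Ψ(x_A + u, x_B + v) Ψ(x_A - u, x_B - v) exp(2i(p_A u + p_B v)) du dv`.
The integral is real (replace `(u, v)` by `(-u, -v)`), so that the real part only changes
the type. -/
def wigner (ψ : TwoMode) (xA pA xB pB : ℝ) : ℝ :=
  ((1 / (Real.pi : ℂ) ^ 2) * ∫ u : ℝ × ℝ,
    (starRingEnd ℂ) (waveFunction ψ (xA + u.1, xB + u.2)) *
      waveFunction ψ (xA - u.1, xB - u.2) *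
        Complex.exp (2 * Complex.I * ((pA * u.1 + pB * u.2 : ℝ) : ℂ))).re

/-- The marginal Wigner distribution of the rotated positions `(x_A^θ, x_B^φ) = (x, y)`: the
Wigner function integrated over the rotated momenta `p_A^θ = p.1`, `p_B^φ = p.2`, where
`x^θ = x cos θ - p sin θ` and `p^θ = x sin θ + p cos θ` in each mode. -/
def marginal (ψ : TwoMode) (θ φ x y : ℝ) : ℝ :=
  ∫ p : ℝ × ℝ, wigner ψ
    (Real.cos θ * x + Real.sin θ * p.1) (-Real.sin θ * x + Real.cos θ * p.1)
    (Real.cos φ * y + Real.sin φ * p.2) (-Real.sin φ * y + Real.cos φ * p.2)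

/-- The sign-binned quadrature correlation function `E_{A,B}^{θ,φ}`. -/
def signCorr (ψ : TwoMode) (θ φ : ℝ) : ℝ :=
  ∫ q : ℝ × ℝ, Real.sign (q.1 * q.2) * marginal ψ θ φ q.1 q.2

/-- The bit quadrature correlations `Q = sup_{θ,φ} |E_{A,B}^{θ,φ}|`. -/
def bitCorr (ψ : TwoMode) : ℝ := ⨆ a : ℝ × ℝ, |signCorr ψ a.1 a.2|

/-! ### Negativity -/

/-- The density operator `|ψ⟩⟨ψ|`. -/
def density (ψ : TwoMode) : TwoMode →L[ℂ] TwoMode := InnerProductSpace.rankOne ℂ ψ ψ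

/-- `τ` is the partial transpose of `ρ` with respect to mode `B` in the Fock basis:
`⟨m,n|τ|k,l⟩ = ⟨m,l|ρ|k,n⟩`. -/
def IsPartialTranspose (ρ τ : TwoMode →L[ℂ] TwoMode) : Prop :=
  ∀ m n k l : ℕ, inner ℂ (ket m n) (τ (ket k l)) = inner ℂ (ket m l) (ρ (ket k n))

theorem IsPartialTranspose.unique {ρ τ σ : TwoMode →L[ℂ] TwoMode}
    (hτ : IsPartialTranspose ρ τ) (hσ : IsPartialTranspose ρ σ) : τ = σ := by
  let b : HilbertBasis (ℕ × ℕ) ℂ TwoMode := ⟨LinearIsometryEquiv.refl ℂ TwoMode⟩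
  have hb : ∀ i, b i = ket i.1 i.2 := fun i => (b.repr_symm_single i).symm
  refine ContinuousLinearMap.ext_on (s := Set.range b)
    ((Submodule.dense_iff_topologicalClosure_eq_top).2 b.dense_span) ?_
  rintro _ ⟨i, rfl⟩
  apply b.repr.injective
  ext j
  simp only [b.repr_apply_apply, hb]
  exact (hτ _ _ _ _).trans (hσ _ _ _ _).symm

open Classical in
/-- The partial transpose of `ρ` (zero if no bounded operator has these matrix elements). -/
def partialTranspose (ρ : TwoMode →L[ℂ] TwoMode) : TwoMode →L[ℂ] TwoMode :=
  if h : ∃ τ, IsPartialTranspose ρ τ then h.choose else 0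

/-- The absolute value `|S| = √(S† S)` of a bounded operator on a complex Hilbert space. -/
def opAbs {E : Type*} [NormedAddCommGroup E] [InnerProductSpace ℂ E] [CompleteSpace E]
    (S : E →L[ℂ] E) : E →L[ℂ] E := CFC.abs S

/-- The trace norm `‖S‖₁ = Tr |S|`, the trace taken in the Fock basis. -/
def traceNorm (S : TwoMode →L[ℂ] TwoMode) : ENNReal :=
  ∑' p : ℕ × ℕ, ENNReal.ofReal (inner ℂ (ket p.1 p.2) (opAbs S (ket p.1 p.2))).re

/-- The negativity `N(ρ) = (‖ρ^{T_B}‖₁ - 1) / 2`. -/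
def negativity (ρ : TwoMode →L[ℂ] TwoMode) : ℝ :=
  ((traceNorm (partialTranspose ρ)).toReal - 1) / 2

/-! ### Photon-subtracted states -/

/-- `c_n(Λ, T) = (n + 1) (TΛ)ⁿ (1 - T²Λ²)^{3/2} / √(T²Λ² + 1)`. -/
def psCoeff (Λ T : ℝ) (n : ℕ) : ℝ :=
  (n + 1) * (T * Λ) ^ n * (1 - T ^ 2 * Λ ^ 2) ^ (3 / 2 : ℝ) / √(T ^ 2 * Λ ^ 2 + 1)

/-- The photon-subtracted state `∑ c_n |n,n⟩` with `Λ = tanh r`. -/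
def psState (r T : ℝ) : TwoMode := ∑' n : ℕ, (psCoeff (Real.tanh r) T n : ℂ) • ket n n

/-- `F(m,n) = [Γ(-m/2) Γ((1-n)/2)]⁻¹`. At a pole of `Γ` Mathlib sets `Γ = 0` and `0⁻¹ = 0`,
which is the value of the entire function `1/Γ` there. -/
def gammaF (m n : ℕ) : ℝ := (Real.Gamma (-(m : ℝ) / 2) * Real.Gamma ((1 - (n : ℝ)) / 2))⁻¹

end

end BitCorr

/-! Only `l = TΛ ∈ [0, 1)` matters, and the `c_n` decay geometrically, so every series below
converges absolutely.

Correlations. The Wigner function is a bounded sesquilinear form in the wave function. Since the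
state is diagonal, it equals `∑ c_m c_n Re (W_mn(x_A,p_A) W_mn(x_B,p_B))`, where `W_mn` is the cross
Wigner function of `h_m` and `h_n` (`hasSum_wigner`). The ladder relations `fockWigner_mul_z` and
`fockWigner_mul_conj_z` reduce `W_mn` to the vacuum Gaussian. They yield continuity, the phase
`exp(i(n-m)θ)` under rotations, and decay with constants polynomial in `m, n`. Fourier inversion
gives `∫ W_mn dp = h_m h_n`. Hence `E^{θ,φ} = ∑ c_m c_n cos((n-m)(θ+φ)) S_mn²` with `S_mn = ∫ sgn(x)
h_m h_n` (`hasSum_signCorr`). All weights are nonnegative, so `θ = φ = 0` is optimal. The diagonal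
vanishes by parity, and symmetry folds the sum onto `m < n`. The oscillator equation makes `h_m h_n`
the derivative of a Wronskian, up to a factor, so `S_mn` depends only on values at `0`
(`sub_mul_signOverlap`), which are reciprocal Gamma values.

Negativity. The partial transpose is the swap composed with the diagonal operator with entries `c_m
c_n`. Its absolute value is that diagonal operator (`opAbs_psSwap`), so its trace norm is `(∑
c_n)²`, a geometric-type sum. -/

namespace BitCorr

noncomputable section

/-! ### Hermite functions and ladder operators -/

open Polynomial in
theorem derivative_hermite_succ (n : ℕ) :
    derivative (hermite (n + 1)) = (n + 1 : ℤ[X]) * hermite n := by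
  induction n with
  | zero => simp [hermite_succ]
  | succ n ih =>
    rw [hermite_succ (n + 1), derivative_sub, derivative_mul, ih, derivative_X,
      derivative_mul, hermite_succ n]
    simp only [Nat.cast_add, Nat.cast_one, derivative_add, derivative_natCast, derivative_one]
    ring

/-- The real polynomial `p_n` with `h_n(x) = p_n(x) exp(-x²/2)`. -/
def hermitePoly (n : ℕ) : Polynomial ℝ :=
  Polynomial.C (√((n.factorial : ℝ) * √Real.pi))⁻¹ *
    ((Polynomial.hermite n).map (Int.castRingHom ℝ)).comp (Polynomial.C (√2) * Polynomial.X)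

theorem hermiteFun_eq (n : ℕ) (x : ℝ) :
    hermiteFun n x = (hermitePoly n).eval x * Real.exp (-x ^ 2 / 2) := by
  simp [hermiteFun, hermitePoly, Polynomial.aeval_def, Polynomial.eval₂_eq_eval_map]
  ring

theorem sqrt_factorial_succ_mul (n : ℕ) :
    √(((n + 1).factorial : ℝ) * √Real.pi) =
      √((n : ℝ) + 1) * √((n.factorial : ℝ) * √Real.pi) := by
  rw [← Real.sqrt_mul (by positivity), Nat.factorial_succ]
  push_cast
  ring_nf

theorem sqrt_factorial_mul_pos (n : ℕ) : 0 < √((n.factorial : ℝ) * √Real.pi) := by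
  have := Real.pi_pos
  positivity

/-- The derivative of `h_n`. -/
def hermiteDeriv (n : ℕ) (x : ℝ) : ℝ := √2 * √(n : ℝ) * hermiteFun (n - 1) x - x * hermiteFun n x

theorem hasDerivAt_hermiteFun (n : ℕ) (x : ℝ) :
    HasDerivAt (hermiteFun n) (hermiteDeriv n x) x := by
  have h1 : HasDerivAt (fun x : ℝ => √2 * x) (√2) x := by
    simpa using (hasDerivAt_id x).const_mul (√2)
  have h2 := ((Polynomial.hermite n).hasDerivAt_aeval (√2 * x)).comp x h1
  have h3 : HasDerivAt (fun x : ℝ => Real.exp (-x ^ 2 / 2)) (Real.exp (-x ^ 2 / 2) * (-x)) x := by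
    have h : HasDerivAt (fun x : ℝ => -x ^ 2 / 2) (-x) x := by
      refine (((hasDerivAt_id x).pow 2).neg.div_const 2).congr_deriv ?_
      simp
      ring
    exact h.exp
  have h4 := (h2.mul h3).div_const (√((n.factorial : ℝ) * √Real.pi))
  refine h4.congr_deriv ?_
  -- At `n = 0` the truncated index `n - 1` is harmless: its coefficient is `√0`.
  cases n with
  | zero =>
    simp [hermiteDeriv, hermiteFun]
    ring
  | succ n =>
    have hs : (√((n : ℝ) + 1)) ^ 2 = (n : ℝ) + 1 := Real.sq_sqrt (by positivity)
    have hp := sqrt_factorial_mul_pos n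
    have hn : 0 < √((n : ℝ) + 1) := by positivity
    simp only [hermiteDeriv, hermiteFun, derivative_hermite_succ, sqrt_factorial_succ_mul,
      Nat.add_sub_cancel, map_mul, map_add, map_natCast, map_one, Nat.cast_add, Nat.cast_one,
      Function.comp]
    field_simp
    rw [hs]
    ring

/-- Eliminating the derivative from `hermite_succ` by `derivative_hermite_succ` leaves a three-term
recurrence. At `n = 0` the factor `√n` kills the truncated index. -/
theorem hermiteFun_succ (n : ℕ) (x : ℝ) :
    √((n : ℝ) + 1) * hermiteFun (n + 1) x =
      √2 * x * hermiteFun n x - √(n : ℝ) * hermiteFun (n - 1) x := by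
  have hp := sqrt_factorial_mul_pos n
  have hn : 0 < √((n : ℝ) + 1) := by positivity
  cases n with
  | zero =>
    simp [hermiteFun, Polynomial.hermite_succ]
    ring
  | succ n =>
    have hs : (√((n : ℝ) + 1)) ^ 2 = (n : ℝ) + 1 := Real.sq_sqrt (by positivity)
    have hp' := sqrt_factorial_mul_pos (n + 1)
    have hp0 := sqrt_factorial_mul_pos n
    have hn' : 0 < √((n : ℝ) + 1) := by positivity
    have e1 : √((n : ℝ) + 1) * hermiteFun n x * √(((n + 1).factorial : ℝ) * √Real.pi) =
        ((n : ℝ) + 1) * (Polynomial.aeval (√2 * x) (Polynomial.hermite n) *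
          Real.exp (-x ^ 2 / 2)) := by
      rw [hermiteFun, sqrt_factorial_succ_mul]
      field_simp
      rw [hs]
    rw [← mul_left_inj' hp'.ne', sub_mul]
    simp only [Nat.add_sub_cancel, Nat.cast_add, Nat.cast_one] at *
    rw [e1, hermiteFun, hermiteFun, sqrt_factorial_succ_mul (n + 1),
      Polynomial.hermite_succ (n + 1), derivative_hermite_succ]
    simp only [map_mul, map_sub, map_add, map_natCast, map_one, Polynomial.aeval_X, Nat.cast_add,
      Nat.cast_one]
    field_simp

/-- Creation operator: `(x - d/dx) h_n = √2 √(n+1) h_{n+1}`. -/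
theorem mul_sub_hermiteDeriv (n : ℕ) (x : ℝ) :
    x * hermiteFun n x - hermiteDeriv n x = √2 * √((n : ℝ) + 1) * hermiteFun (n + 1) x := by
  have h2 : √2 * √2 = (2 : ℝ) := Real.mul_self_sqrt (by norm_num)
  rw [hermiteDeriv, mul_assoc (√2) (√((n : ℝ) + 1)), hermiteFun_succ]
  linear_combination (-(x * hermiteFun n x)) * h2

/-- Annihilation operator: `(x + d/dx) h_n = √2 √n h_{n-1}`. -/
theorem mul_add_hermiteDeriv (n : ℕ) (x : ℝ) :
    x * hermiteFun n x + hermiteDeriv n x = √2 * √(n : ℝ) * hermiteFun (n - 1) x := by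
  rw [hermiteDeriv]
  ring

theorem hermiteFun_neg (n : ℕ) (x : ℝ) : hermiteFun n (-x) = (-1) ^ n * hermiteFun n x := by
  induction n using Nat.strong_induction_on with
  | _ n ih =>
    cases n with
    | zero => simp [hermiteFun]
    | succ n =>
      have hn : 0 < √((n : ℝ) + 1) := by positivity
      rw [← mul_right_inj' hn.ne', hermiteFun_succ, ih n (by omega),
        mul_left_comm (√((n : ℝ) + 1)), hermiteFun_succ]
      cases n with
      | zero => simp
      | succ k =>
        rw [Nat.add_sub_cancel, ih k (by omega)]
        ring

/-- Products `f(x + u) g(x - u)` of polynomials times Gaussians are integrable in `u`. -/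
theorem integrable_mul_shift (P Q : Polynomial ℝ) (x : ℝ) :
    Integrable (fun u : ℝ => (P.eval (x + u) * Real.exp (-(x + u) ^ 2 / 2)) *
      (Q.eval (x - u) * Real.exp (-(x - u) ^ 2 / 2))) := by
  have h := (integrable_poly_mul_exp ((P.comp (Polynomial.C x + Polynomial.X)) *
    Q.comp (Polynomial.C x - Polynomial.X))).const_mul (Real.exp (-x ^ 2))
  refine h.congr (Filter.Eventually.of_forall fun u => ?_)
  have he : Real.exp (-(x + u) ^ 2 / 2) * Real.exp (-(x - u) ^ 2 / 2) =
      Real.exp (-x ^ 2) * Real.exp (-u ^ 2) := by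
    rw [← Real.exp_add, ← Real.exp_add]
    congr 1
    ring
  simp only [Polynomial.eval_mul, Polynomial.eval_comp, Polynomial.eval_add, Polynomial.eval_sub,
    Polynomial.eval_C, Polynomial.eval_X]
  linear_combination (-(P.eval (x + u) * Q.eval (x - u))) * he

theorem integrable_hermiteFun_mul (m n : ℕ) :
    Integrable (fun x : ℝ => hermiteFun m x * hermiteFun n x) := by
  refine (integrable_poly_mul_exp (hermitePoly m * hermitePoly n)).congr
    (Filter.Eventually.of_forall fun x => ?_)
  have he : Real.exp (-x ^ 2) = Real.exp (-x ^ 2 / 2) ^ 2 := by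
    rw [← Real.exp_nat_mul]
    congr 1
    push_cast
    ring
  simp only [hermiteFun_eq, Polynomial.eval_mul, he]
  ring

theorem integrable_hermiteFun_mul_hermiteDeriv (m n : ℕ) :
    Integrable (fun x : ℝ => hermiteFun m x * hermiteDeriv n x) := by
  -- The difference of the two ladder identities is `h_n' = (√2/2)(√n h_{n-1} - √(n+1) h_{n+1})`.
  refine (((integrable_hermiteFun_mul m (n - 1)).const_mul (√(n : ℝ))).sub
    ((integrable_hermiteFun_mul m (n + 1)).const_mul (√((n : ℝ) + 1)))).mul_const (√2 / 2) |>.congr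
    (Filter.Eventually.of_forall fun x => ?_)
  simp only [Pi.sub_apply]
  linear_combination (-hermiteFun m x / 2) * mul_add_hermiteDeriv n x
    + (hermiteFun m x / 2) * mul_sub_hermiteDeriv n x

/-! ### Cross Wigner functions: ladder relations and rotations -/

/-- The integrand of the cross Wigner function of `h_m` and `h_n`. -/
def fockWignerIntegrand (m n : ℕ) (x p u : ℝ) : ℂ :=
  ((hermiteFun m (x + u) * hermiteFun n (x - u) : ℝ) : ℂ) *
    Complex.exp (2 * Complex.I * ((p * u : ℝ) : ℂ))

/-- The single-mode cross Wigner function of `h_m` and `h_n`. -/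
def fockWigner (m n : ℕ) (x p : ℝ) : ℂ :=
  (1 / (Real.pi : ℂ)) * ∫ u : ℝ, fockWignerIntegrand m n x p u

theorem norm_exp_two_I_mul (t : ℝ) : ‖Complex.exp (2 * Complex.I * (t : ℂ))‖ = 1 := by
  rw [show 2 * Complex.I * (t : ℂ) = ((2 * t : ℝ) : ℂ) * Complex.I by push_cast; ring]
  exact Complex.norm_exp_ofReal_mul_I _

theorem integrable_hermiteFun_mul_shift (m n : ℕ) (x : ℝ) :
    Integrable (fun u : ℝ => hermiteFun m (x + u) * hermiteFun n (x - u)) := by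
  simp only [hermiteFun_eq]
  exact integrable_mul_shift _ _ x

theorem Integrable.ofReal_mul_exp {f : ℝ → ℝ} (hf : Integrable f) (p : ℝ) :
    Integrable (fun u : ℝ => (f u : ℂ) * Complex.exp (2 * Complex.I * ((p * u : ℝ) : ℂ))) := by
  refine hf.ofReal.mul_bdd (c := 1) ?_ (Filter.Eventually.of_forall fun u => ?_)
  · exact Continuous.aestronglyMeasurable (by fun_prop)
  · exact (norm_exp_two_I_mul _).le

theorem integrable_fockWignerIntegrand (m n : ℕ) (x p : ℝ) :
    Integrable (fockWignerIntegrand m n x p) :=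
  Integrable.ofReal_mul_exp (integrable_hermiteFun_mul_shift m n x) p

/-- Derivative in `u` of `h_m(x + u) h_n(x - u)`. -/
def shiftDeriv (m n : ℕ) (x u : ℝ) : ℝ :=
  hermiteDeriv m (x + u) * hermiteFun n (x - u) - hermiteFun m (x + u) * hermiteDeriv n (x - u)

theorem hasDerivAt_mul_shift (m n : ℕ) (x u : ℝ) :
    HasDerivAt (fun u => hermiteFun m (x + u) * hermiteFun n (x - u)) (shiftDeriv m n x u) u := by
  have h1 := (hasDerivAt_hermiteFun m (x + u)).comp u ((hasDerivAt_id u).const_add x)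
  have h2 := (hasDerivAt_hermiteFun n (x - u)).comp u ((hasDerivAt_id u).const_sub x)
  refine (h1.mul h2).congr_deriv ?_
  simp [shiftDeriv]
  ring

/-- Creation acts at `x + u` and annihilation at `x - u`: the positions add up to `2x`, while the
derivatives assemble into `d/du`. -/
theorem shiftDeriv_raise (m n : ℕ) (x u : ℝ) :
    √2 * √((m : ℝ) + 1) * (hermiteFun (m + 1) (x + u) * hermiteFun n (x - u)) +
        √2 * √(n : ℝ) * (hermiteFun m (x + u) * hermiteFun (n - 1) (x - u)) =
      2 * x * (hermiteFun m (x + u) * hermiteFun n (x - u)) - shiftDeriv m n x u := by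
  rw [shiftDeriv]
  linear_combination (-hermiteFun n (x - u)) * mul_sub_hermiteDeriv m (x + u) -
    hermiteFun m (x + u) * mul_add_hermiteDeriv n (x - u)

theorem shiftDeriv_lower (m n : ℕ) (x u : ℝ) :
    √2 * √(m : ℝ) * (hermiteFun (m - 1) (x + u) * hermiteFun n (x - u)) +
        √2 * √((n : ℝ) + 1) * (hermiteFun m (x + u) * hermiteFun (n + 1) (x - u)) =
      2 * x * (hermiteFun m (x + u) * hermiteFun n (x - u)) + shiftDeriv m n x u := by
  rw [shiftDeriv]
  linear_combination (-hermiteFun n (x - u)) * mul_add_hermiteDeriv m (x + u) -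
    hermiteFun m (x + u) * mul_sub_hermiteDeriv n (x - u)

theorem integrable_shiftDeriv (m n : ℕ) (x : ℝ) : Integrable (shiftDeriv m n x) := by
  refine ((((integrable_hermiteFun_mul_shift m n x).const_mul (2 * x)).sub
    ((integrable_hermiteFun_mul_shift (m + 1) n x).const_mul (√2 * √((m : ℝ) + 1)))).sub
    ((integrable_hermiteFun_mul_shift m (n - 1) x).const_mul (√2 * √(n : ℝ)))).congr
    (Filter.Eventually.of_forall fun u => ?_)
  simp only [Pi.sub_apply]
  linear_combination (-1 : ℝ) * shiftDeriv_raise m n x u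

/-- Integration by parts moves `d/du` onto the exponential; this is how the momentum part of `z`
arises. -/
theorem integral_shiftDeriv_mul_exp (m n : ℕ) (x p : ℝ) :
    ∫ u : ℝ, (shiftDeriv m n x u : ℂ) * Complex.exp (2 * Complex.I * ((p * u : ℝ) : ℂ)) =
      -(2 * Complex.I * p) * ∫ u : ℝ, fockWignerIntegrand m n x p u := by
  have hd : ∀ u : ℝ, HasDerivAt
      (fun u : ℝ => Complex.exp (2 * Complex.I * ((p * u : ℝ) : ℂ)))
      (2 * Complex.I * p * Complex.exp (2 * Complex.I * ((p * u : ℝ) : ℂ))) u := by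
    intro u
    have h : HasDerivAt (fun u : ℝ => 2 * Complex.I * ((p * u : ℝ) : ℂ)) (2 * Complex.I * p) u := by
      have := (((hasDerivAt_id u).const_mul p).ofReal_comp).const_mul (2 * Complex.I)
      simpa using this
    exact h.cexp.congr_deriv (by ring)
  have key := integral_mul_deriv_eq_deriv_mul_of_integrable
    (fun u _ => (hasDerivAt_mul_shift m n x u).ofReal_comp) (fun u _ => hd u) ?_ ?_ ?_
  · rw [← integral_const_mul, ← neg_eq_iff_eq_neg.mpr key, ← integral_neg]
    refine integral_congr_ae (Filter.Eventually.of_forall fun u => ?_)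
    simp only [fockWignerIntegrand]
    ring
  · refine ((integrable_fockWignerIntegrand m n x p).const_mul (2 * Complex.I * p)).congr
      (Filter.Eventually.of_forall fun u => ?_)
    simp only [fockWignerIntegrand, Pi.mul_apply]
    ring
  · exact Integrable.ofReal_mul_exp (integrable_shiftDeriv m n x) p
  · exact integrable_fockWignerIntegrand m n x p

theorem sqrt_two_mul_self : (√2 : ℂ) * (√2 : ℂ) = 2 := by
  rw [← Complex.ofReal_mul, Real.mul_self_sqrt (by norm_num)]
  norm_num

/-- Multiplication of a cross Wigner function by `z = x + ip`. -/
theorem fockWigner_mul_z (m n : ℕ) (x p : ℝ) :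
    (√((m : ℝ) + 1) : ℂ) * fockWigner (m + 1) n x p + (√(n : ℝ) : ℂ) * fockWigner m (n - 1) x p =
      (√2 : ℂ) * (x + Complex.I * p) * fockWigner m n x p := by
  have h : ∫ u : ℝ, ((√2 : ℂ) * (√((m : ℝ) + 1) : ℂ) * fockWignerIntegrand (m + 1) n x p u +
      (√2 : ℂ) * (√(n : ℝ) : ℂ) * fockWignerIntegrand m (n - 1) x p u) =
      ∫ u : ℝ, (2 * (x : ℂ) * fockWignerIntegrand m n x p u -
        (shiftDeriv m n x u : ℂ) * Complex.exp (2 * Complex.I * ((p * u : ℝ) : ℂ))) := by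
    refine integral_congr_ae (Filter.Eventually.of_forall fun u => ?_)
    have := congrArg (fun t : ℝ => (t : ℂ)) (shiftDeriv_raise m n x u)
    push_cast at this
    simp only [fockWignerIntegrand]
    push_cast
    linear_combination Complex.exp (2 * Complex.I * (p * u)) * this
  rw [integral_add ((integrable_fockWignerIntegrand _ _ _ _).const_mul _)
    ((integrable_fockWignerIntegrand _ _ _ _).const_mul _),
    integral_sub ((integrable_fockWignerIntegrand _ _ _ _).const_mul _)
    (Integrable.ofReal_mul_exp (integrable_shiftDeriv m n x) p), integral_shiftDeriv_mul_exp,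
    integral_const_mul, integral_const_mul, integral_const_mul] at h
  simp only [fockWigner]
  linear_combination ((√2 : ℂ) * (1 / (Real.pi : ℂ)) / 2) * h - (1 / (Real.pi : ℂ)) / 2 *
    ((√((m : ℝ) + 1) : ℂ) * (∫ u : ℝ, fockWignerIntegrand (m + 1) n x p u) +
      (√(n : ℝ) : ℂ) * ∫ u : ℝ, fockWignerIntegrand m (n - 1) x p u) * sqrt_two_mul_self

/-- Multiplication of a cross Wigner function by `z̄ = x - ip`. -/
theorem fockWigner_mul_conj_z (m n : ℕ) (x p : ℝ) :
    (√(m : ℝ) : ℂ) * fockWigner (m - 1) n x p + (√((n : ℝ) + 1) : ℂ) * fockWigner m (n + 1) x p =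
      (√2 : ℂ) * (x - Complex.I * p) * fockWigner m n x p := by
  have h : ∫ u : ℝ, ((√2 : ℂ) * (√(m : ℝ) : ℂ) * fockWignerIntegrand (m - 1) n x p u +
      (√2 : ℂ) * (√((n : ℝ) + 1) : ℂ) * fockWignerIntegrand m (n + 1) x p u) =
      ∫ u : ℝ, (2 * (x : ℂ) * fockWignerIntegrand m n x p u +
        (shiftDeriv m n x u : ℂ) * Complex.exp (2 * Complex.I * ((p * u : ℝ) : ℂ))) := by
    refine integral_congr_ae (Filter.Eventually.of_forall fun u => ?_)
    have := congrArg (fun t : ℝ => (t : ℂ)) (shiftDeriv_lower m n x u)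
    push_cast at this
    simp only [fockWignerIntegrand]
    push_cast
    linear_combination Complex.exp (2 * Complex.I * (p * u)) * this
  rw [integral_add ((integrable_fockWignerIntegrand _ _ _ _).const_mul _)
    ((integrable_fockWignerIntegrand _ _ _ _).const_mul _),
    integral_add ((integrable_fockWignerIntegrand _ _ _ _).const_mul _)
    (Integrable.ofReal_mul_exp (integrable_shiftDeriv m n x) p), integral_shiftDeriv_mul_exp,
    integral_const_mul, integral_const_mul, integral_const_mul] at h
  simp only [fockWigner]
  linear_combination ((√2 : ℂ) * (1 / (Real.pi : ℂ)) / 2) * h - (1 / (Real.pi : ℂ)) / 2 *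
    ((√(m : ℝ) : ℂ) * (∫ u : ℝ, fockWignerIntegrand (m - 1) n x p u) +
      (√((n : ℝ) + 1) : ℂ) * ∫ u : ℝ, fockWignerIntegrand m (n + 1) x p u) * sqrt_two_mul_self

/-- The vacuum Wigner function. -/
theorem fockWigner_zero_zero (x p : ℝ) :
    fockWigner 0 0 x p = ((Real.exp (-(x ^ 2 + p ^ 2)) / Real.pi : ℝ) : ℂ) := by
  have hpi : (0 : ℝ) < √Real.pi := Real.sqrt_pos.2 Real.pi_pos
  have hb := fourierIntegral_gaussian (b := 1) (by norm_num) (2 * p : ℂ)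
  have h1 : ∀ u : ℝ, fockWignerIntegrand 0 0 x p u =
      ((Real.exp (-x ^ 2) / √Real.pi : ℝ) : ℂ) *
        (Complex.exp (Complex.I * (2 * p : ℂ) * u) * Complex.exp (-(1 : ℂ) * (u : ℂ) ^ 2)) := by
    intro u
    have he : hermiteFun 0 (x + u) * hermiteFun 0 (x - u) =
        Real.exp (-x ^ 2) / √Real.pi * Real.exp (-u ^ 2) := by
      have h0 : ∀ y, hermiteFun 0 y = Real.exp (-y ^ 2 / 2) / √(√Real.pi) := by
        intro y
        simp [hermiteFun]
      have e : Real.exp (-(x + u) ^ 2 / 2) * Real.exp (-(x - u) ^ 2 / 2) =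
          Real.exp (-x ^ 2) * Real.exp (-u ^ 2) := by
        rw [← Real.exp_add, ← Real.exp_add]
        congr 1
        ring
      rw [h0, h0, div_mul_div_comm, Real.mul_self_sqrt hpi.le, e]
      ring
    rw [fockWignerIntegrand, he]
    push_cast
    rw [show 2 * Complex.I * ((p : ℂ) * u) = Complex.I * (2 * p) * u by ring,
      show -(1 : ℂ) * (u : ℂ) ^ 2 = -(u : ℂ) ^ 2 by ring]
    ring
  rw [fockWigner, integral_congr_ae (Filter.Eventually.of_forall h1), integral_const_mul, hb]
  have hs : ((Real.pi : ℂ) / 1) ^ (1 / 2 : ℂ) = ((√Real.pi : ℝ) : ℂ) := by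
    rw [div_one, Real.sqrt_eq_rpow, Complex.ofReal_cpow Real.pi_pos.le]
    norm_num
  rw [hs, neg_add, Real.exp_add]
  have e2 : Complex.exp (-(2 * p : ℂ) ^ 2 / (4 * 1)) = ((Real.exp (-p ^ 2) : ℝ) : ℂ) := by
    push_cast
    congr 1
    ring
  rw [e2]
  have hne : ((√Real.pi : ℝ) : ℂ) ≠ 0 := by exact_mod_cast hpi.ne'
  push_cast
  field_simp

theorem sqrt_natCast_add_one_ne_zero (n : ℕ) : (√((n : ℝ) + 1) : ℂ) ≠ 0 := by
  have : 0 < √((n : ℝ) + 1) := by positivity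
  exact_mod_cast this.ne'

/-- Together with `fockWigner_zero_succ` for the row `m = 0`, this generates every cross Wigner
function from the vacuum, which is the scheme of the inductions for continuity and rotation. -/
theorem fockWigner_succ_left (m n : ℕ) (x p : ℝ) :
    fockWigner (m + 1) n x p = ((√2 : ℂ) * (x + Complex.I * p) * fockWigner m n x p -
      (√(n : ℝ) : ℂ) * fockWigner m (n - 1) x p) / (√((m : ℝ) + 1) : ℂ) := by
  rw [eq_div_iff (sqrt_natCast_add_one_ne_zero m)]
  linear_combination fockWigner_mul_z m n x p

theorem fockWigner_zero_succ (n : ℕ) (x p : ℝ) :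
    fockWigner 0 (n + 1) x p =
      (√2 : ℂ) * (x - Complex.I * p) * fockWigner 0 n x p / (√((n : ℝ) + 1) : ℂ) := by
  rw [eq_div_iff (sqrt_natCast_add_one_ne_zero n)]
  have h := fockWigner_mul_conj_z 0 n x p
  simp only [Nat.cast_zero, Real.sqrt_zero, Complex.ofReal_zero, zero_mul, zero_add] at h
  linear_combination h

theorem continuous_fockWigner (m n : ℕ) :
    Continuous (fun q : ℝ × ℝ => fockWigner m n q.1 q.2) := by
  induction m generalizing n with
  | zero =>
    induction n with
    | zero =>
      simp only [fockWigner_zero_zero]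
      fun_prop
    | succ n ih =>
      simp only [fockWigner_zero_succ]
      fun_prop
  | succ m ih =>
    have h1 := ih n
    have h2 := ih (n - 1)
    simp only [fockWigner_succ_left]
    fun_prop

/-- Phase-space rotations act on cross Wigner functions by phases. -/
theorem fockWigner_rotate (m n : ℕ) (θ x p : ℝ) :
    fockWigner m n (Real.cos θ * x + Real.sin θ * p) (-Real.sin θ * x + Real.cos θ * p) =
      Complex.exp (-(θ * Complex.I)) ^ m * Complex.exp (θ * Complex.I) ^ n *
        fockWigner m n x p := by
  have hE : Complex.exp (-(θ * Complex.I)) = Complex.cos θ - Complex.sin θ * Complex.I := by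
    rw [← neg_mul, Complex.exp_mul_I, Complex.cos_neg, Complex.sin_neg]
    ring
  have hE' : Complex.exp (θ * Complex.I) = Complex.cos θ + Complex.sin θ * Complex.I :=
    Complex.exp_mul_I _
  have hEE : Complex.exp (-(θ * Complex.I)) * Complex.exp (θ * Complex.I) = 1 := by
    rw [← Complex.exp_add]
    simp
  -- The rotation multiplies `z` by `exp(-iθ)` and `z̄` by `exp(iθ)`, so raising `m` or `n`
  -- contributes one such factor.
  have hz : (((Real.cos θ * x + Real.sin θ * p : ℝ) : ℂ) +
      Complex.I * ((-Real.sin θ * x + Real.cos θ * p : ℝ) : ℂ)) =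
      Complex.exp (-(θ * Complex.I)) * (x + Complex.I * p) := by
    rw [hE]
    push_cast
    linear_combination (Complex.sin θ * p) * Complex.I_mul_I
  have hz' : (((Real.cos θ * x + Real.sin θ * p : ℝ) : ℂ) -
      Complex.I * ((-Real.sin θ * x + Real.cos θ * p : ℝ) : ℂ)) =
      Complex.exp (θ * Complex.I) * (x - Complex.I * p) := by
    rw [hE']
    push_cast
    linear_combination (Complex.sin θ * p) * Complex.I_mul_I
  induction m generalizing n with
  | zero =>
    induction n with
    | zero =>
      rw [fockWigner_zero_zero, fockWigner_zero_zero, pow_zero, pow_zero, one_mul, one_mul]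
      congr 4
      linear_combination (x ^ 2 + p ^ 2) * Real.sin_sq_add_cos_sq θ
    | succ n ih =>
      rw [fockWigner_zero_succ, fockWigner_zero_succ, ih, hz']
      ring
  | succ m ih =>
    rw [fockWigner_succ_left, fockWigner_succ_left, ih, ih, hz]
    cases n with
    | zero =>
      simp
      ring
    | succ n =>
      rw [Nat.add_sub_cancel]
      -- The lowered term lacks one phase of each kind; the two missing phases cancel.
      linear_combination (√((n + 1 : ℕ) : ℝ) : ℂ) * Complex.exp (-(θ * Complex.I)) ^ m *
        Complex.exp (θ * Complex.I) ^ n * fockWigner m n x p / (√((m : ℝ) + 1) : ℂ) * hEE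

theorem norm_fockWigner_rotate (m n : ℕ) (θ x p : ℝ) :
    ‖fockWigner m n (Real.cos θ * x + Real.sin θ * p) (-Real.sin θ * x + Real.cos θ * p)‖ =
      ‖fockWigner m n x p‖ := by
  have h : Complex.exp (-(θ * Complex.I)) = Complex.exp ((-θ : ℝ) * Complex.I) := by
    push_cast
    ring_nf
  rw [fockWigner_rotate, norm_mul, norm_mul, norm_pow, norm_pow, h,
    Complex.norm_exp_ofReal_mul_I, Complex.norm_exp_ofReal_mul_I]
  simp

/-! ### Normalization, decay and momentum marginals -/

/-- At `z = 0` the ladder relation says that consecutive diagonal values are opposite. -/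
theorem fockWigner_self_zero (n : ℕ) : fockWigner n n 0 0 = (-1) ^ n / (Real.pi : ℂ) := by
  induction n with
  | zero => simp [fockWigner_zero_zero]
  | succ n ih =>
    have h := fockWigner_mul_z n (n + 1) 0 0
    have h0 := sqrt_natCast_add_one_ne_zero n
    rw [Nat.add_sub_cancel, ih] at h
    push_cast at h
    rw [← mul_right_inj' h0]
    linear_combination h

/-- By parity, the value of the diagonal Wigner function at the origin is `(-1)^n / π` times the
squared norm. -/
theorem integral_hermiteFun_sq (n : ℕ) : ∫ x : ℝ, hermiteFun n x ^ 2 = 1 := by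
  have h := fockWigner_self_zero n
  have h1 : ∀ u : ℝ, fockWignerIntegrand n n 0 0 u =
      (-1) ^ n * ((hermiteFun n u ^ 2 : ℝ) : ℂ) := by
    intro u
    rw [fockWignerIntegrand, zero_add, zero_sub, hermiteFun_neg]
    push_cast
    simp
    ring
  rw [fockWigner, integral_congr_ae (Filter.Eventually.of_forall h1), integral_const_mul,
    integral_complex_ofReal] at h
  have hpi : (Real.pi : ℂ) ≠ 0 := by exact_mod_cast Real.pi_ne_zero
  field_simp at h
  exact_mod_cast h

theorem integral_norm_fockWignerIntegrand_le (m n : ℕ) (x p : ℝ) :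
    ∫ u : ℝ, ‖fockWignerIntegrand m n x p u‖ ≤ 1 := by
  have i1 : Integrable (fun u : ℝ => hermiteFun m (x + u) ^ 2) :=
    (integrable_hermiteFun_sq m).comp_add_left x
  have i2 : Integrable (fun u : ℝ => hermiteFun n (x - u) ^ 2) :=
    (integrable_hermiteFun_sq n).comp_sub_left x
  have hle : ∫ u : ℝ, ‖fockWignerIntegrand m n x p u‖ ≤
      ∫ u : ℝ, (hermiteFun m (x + u) ^ 2 + hermiteFun n (x - u) ^ 2) / 2 := by
    refine integral_mono (integrable_fockWignerIntegrand m n x p).norm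
      ((i1.add i2).div_const 2) fun u => ?_
    simp only [fockWignerIntegrand, norm_mul, norm_exp_two_I_mul, mul_one, Complex.norm_real,
      Real.norm_eq_abs]
    nlinarith [sq_nonneg (|hermiteFun m (x + u)| - |hermiteFun n (x - u)|),
      sq_abs (hermiteFun m (x + u)), sq_abs (hermiteFun n (x - u))]
  rw [integral_div, integral_add i1 i2,
    integral_add_left_eq_self (fun u => hermiteFun m u ^ 2) x,
    integral_sub_left_eq_self (fun u => hermiteFun n u ^ 2) volume x,
    integral_hermiteFun_sq, integral_hermiteFun_sq] at hle
  linarith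

theorem norm_fockWigner_le (m n : ℕ) (x p : ℝ) : ‖fockWigner m n x p‖ ≤ 1 := by
  have h := (norm_integral_le_integral_norm (fockWignerIntegrand m n x p)).trans
    (integral_norm_fockWignerIntegrand_le m n x p)
  rw [fockWigner, norm_mul, norm_div, norm_one, Complex.norm_real, Real.norm_of_nonneg
    Real.pi_pos.le]
  have h3 : 1 / Real.pi ≤ 1 := by
    rw [div_le_one Real.pi_pos]
    linarith [Real.pi_gt_three]
  exact mul_le_one₀ h3 (norm_nonneg _) h

/-- Each power of `z` is traded by `fockWigner_mul_z` for neighbouring indices. A bound polynomial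
in `m, n` is enough against geometrically decaying coefficients. -/
theorem norm_pow_mul_fockWigner_le (k m n : ℕ) (x p : ℝ) :
    ‖(x + Complex.I * p : ℂ)‖ ^ k * ‖fockWigner m n x p‖ ≤ ((m : ℝ) + n + k) ^ k := by
  induction k generalizing m n with
  | zero => simpa using norm_fockWigner_le m n x p
  | succ k ih =>
    have h2 : (0 : ℝ) < √2 := by positivity
    have hz := congrArg norm (fockWigner_mul_z m n x p)
    rw [norm_mul, norm_mul, Complex.norm_real, Real.norm_of_nonneg h2.le] at hz
    have hle := norm_add_le ((√((m : ℝ) + 1) : ℂ) * fockWigner (m + 1) n x p)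
      ((√(n : ℝ) : ℂ) * fockWigner m (n - 1) x p)
    rw [hz, norm_mul, norm_mul, Complex.norm_real, Complex.norm_real,
      Real.norm_of_nonneg (Real.sqrt_nonneg _), Real.norm_of_nonneg (Real.sqrt_nonneg _)] at hle
    set Z := ‖(x + Complex.I * p : ℂ)‖ with hZ
    set S : ℝ := (m : ℝ) + n + (k + 1) with hS
    have hS0 : 0 ≤ S := by positivity
    have hk1 : Z ^ k * ‖fockWigner (m + 1) n x p‖ ≤ S ^ k := by
      refine (ih (m + 1) n).trans (le_of_eq ?_)
      push_cast
      rw [hS]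
      ring
    have hk2 : Z ^ k * ‖fockWigner m (n - 1) x p‖ ≤ S ^ k := by
      refine (ih m (n - 1)).trans ?_
      have : ((n - 1 : ℕ) : ℝ) ≤ n := by exact_mod_cast Nat.sub_le n 1
      refine pow_le_pow_left₀ (by positivity) ?_ k
      rw [hS]
      linarith
    -- `(√a + √b)² ≤ 2(a + b) ≤ 2S ≤ 2S²`, using `S ≥ 1`.
    have hm : √((m : ℝ) + 1) + √(n : ℝ) ≤ √2 * S := by
      have ha := Real.sq_sqrt (show (0 : ℝ) ≤ (m : ℝ) + 1 by positivity)
      have hb := Real.sq_sqrt (show (0 : ℝ) ≤ (n : ℝ) by positivity)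
      have hc := Real.sq_sqrt (show (0 : ℝ) ≤ 2 by norm_num)
      have hT : 1 ≤ S := by
        rw [hS]
        have : (0 : ℝ) ≤ m + n + k := by positivity
        linarith
      have hmn : (m : ℝ) + 1 + n ≤ S := by
        rw [hS]
        have : (0 : ℝ) ≤ k := by positivity
        linarith
      refine abs_le_of_sq_le_sq' ?_ (by positivity) |>.2
      have : (√2 * S) ^ 2 = 2 * S ^ 2 := by rw [mul_pow, hc]
      nlinarith [sq_nonneg (√((m : ℝ) + 1) - √(n : ℝ))]
    have hZk : 0 ≤ Z ^ k := by positivity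
    have hfin : √2 * (Z ^ (k + 1) * ‖fockWigner m n x p‖) ≤ √2 * S ^ (k + 1) := by
      calc √2 * (Z ^ (k + 1) * ‖fockWigner m n x p‖)
          = Z ^ k * (√2 * Z * ‖fockWigner m n x p‖) := by ring
        _ ≤ Z ^ k * (√((m : ℝ) + 1) * ‖fockWigner (m + 1) n x p‖ +
            √(n : ℝ) * ‖fockWigner m (n - 1) x p‖) := mul_le_mul_of_nonneg_left hle hZk
        _ = √((m : ℝ) + 1) * (Z ^ k * ‖fockWigner (m + 1) n x p‖) +
            √(n : ℝ) * (Z ^ k * ‖fockWigner m (n - 1) x p‖) := by ring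
        _ ≤ √((m : ℝ) + 1) * S ^ k + √(n : ℝ) * S ^ k := by gcongr
        _ = (√((m : ℝ) + 1) + √(n : ℝ)) * S ^ k := by ring
        _ ≤ √2 * S * S ^ k := by gcongr
        _ = √2 * S ^ (k + 1) := by ring
    have := le_of_mul_le_mul_left hfin h2
    push_cast
    exact this

/-- Integrable weight dominating all cross Wigner functions. -/
def phaseWeight (x p : ℝ) : ℝ := (1 + x ^ 2)⁻¹ * (1 + p ^ 2)⁻¹

theorem phaseWeight_nonneg (x p : ℝ) : 0 ≤ phaseWeight x p := by
  unfold phaseWeight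
  positivity

/-- Since `(1 + x²)(1 + p²) ≤ 1 + 2|z|² + |z|⁴`, the moments `0, 2, 4` suffice; the constant is `4 =
1 + 2 + 1`. -/
theorem norm_fockWigner_le_phaseWeight (m n : ℕ) (x p : ℝ) :
    ‖fockWigner m n x p‖ ≤ 4 * ((m : ℝ) + n + 4) ^ 4 * phaseWeight x p := by
  have h0 := norm_fockWigner_le m n x p
  have h2 := norm_pow_mul_fockWigner_le 2 m n x p
  have h4 := norm_pow_mul_fockWigner_le 4 m n x p
  have hz : ‖(x + Complex.I * p : ℂ)‖ ^ 2 = x ^ 2 + p ^ 2 := by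
    rw [← Complex.normSq_eq_norm_sq, Complex.normSq_apply]
    simp
    ring
  have h22 : ‖(x + Complex.I * p : ℂ)‖ ^ 4 = (x ^ 2 + p ^ 2) ^ 2 := by
    rw [← hz]
    ring
  rw [hz] at h2
  rw [h22] at h4
  push_cast at h2 h4
  set S : ℝ := (m : ℝ) + n + 4 with hS
  have hS1 : 1 ≤ S := by
    rw [hS]
    have : (0 : ℝ) ≤ m + n := by positivity
    linarith
  have e2 : ((m : ℝ) + n + 2) ^ 2 ≤ S ^ 4 := by
    calc ((m : ℝ) + n + 2) ^ 2 ≤ S ^ 2 := by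
          refine pow_le_pow_left₀ (by positivity) ?_ 2
          rw [hS]
          linarith
      _ ≤ S ^ 4 := pow_le_pow_right₀ hS1 (by norm_num)
  have e0 : 1 ≤ S ^ 4 := one_le_pow₀ hS1
  rw [phaseWeight, ← mul_inv, ← div_eq_mul_inv, le_div_iff₀ (by positivity)]
  have hn := norm_nonneg (fockWigner m n x p)
  have hxp : (1 + x ^ 2) * (1 + p ^ 2) ≤ 1 + 2 * (x ^ 2 + p ^ 2) + (x ^ 2 + p ^ 2) ^ 2 := by
    nlinarith [sq_nonneg (x ^ 2), sq_nonneg (p ^ 2), sq_nonneg x, sq_nonneg p,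
      mul_nonneg (sq_nonneg x) (sq_nonneg p)]
  calc ‖fockWigner m n x p‖ * ((1 + x ^ 2) * (1 + p ^ 2))
      ≤ ‖fockWigner m n x p‖ * (1 + 2 * (x ^ 2 + p ^ 2) + (x ^ 2 + p ^ 2) ^ 2) := by gcongr
    _ ≤ 4 * S ^ 4 := by linarith

theorem integrable_phaseWeight_right (x : ℝ) : Integrable (phaseWeight x) :=
  integrable_inv_one_add_sq.const_mul _

theorem integrable_phaseWeight : Integrable (fun q : ℝ × ℝ => phaseWeight q.1 q.2) :=
  integrable_inv_one_add_sq.mul_prod integrable_inv_one_add_sq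

theorem integrable_fockWigner_right (m n : ℕ) (x : ℝ) : Integrable (fockWigner m n x) := by
  refine ((integrable_phaseWeight_right x).const_mul (4 * ((m : ℝ) + n + 4) ^ 4)).mono' ?_
    (Filter.Eventually.of_forall fun p => norm_fockWigner_le_phaseWeight m n x p)
  exact ((continuous_fockWigner m n).comp (by fun_prop : Continuous fun p : ℝ => (x, p))
    ).aestronglyMeasurable

-- Fourier inversion at `u = 0` for `u ↦ h_m(x+u) h_n(x-u)`. The normalization of `𝓕` forces the
-- argument `-p/π`, whose Jacobian cancels the prefactor `1/π`; integrability of the transform comes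
-- from the decay of `fockWigner`.
open FourierTransform in
theorem integral_fockWigner_right (m n : ℕ) (x : ℝ) :
    ∫ p : ℝ, fockWigner m n x p = ((hermiteFun m x * hermiteFun n x : ℝ) : ℂ) := by
  set f : ℝ → ℂ := fun u => ((hermiteFun m (x + u) * hermiteFun n (x - u) : ℝ) : ℂ) with hf
  have hpi := Real.pi_ne_zero
  have hfc : Continuous f := by
    have h1 := continuous_hermiteFun m
    have h2 := continuous_hermiteFun n
    rw [hf]
    fun_prop
  have hfi : Integrable f := (integrable_hermiteFun_mul_shift m n x).ofReal
  have hF : ∀ p : ℝ, fockWigner m n x p = (1 / (Real.pi : ℂ)) * 𝓕 f (-(Real.pi)⁻¹ * p) := by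
    intro p
    rw [fockWigner, Real.fourier_real_eq_integral_exp_smul]
    congr 1
    refine integral_congr_ae (Filter.Eventually.of_forall fun u => ?_)
    simp only [fockWignerIntegrand, hf, smul_eq_mul]
    rw [mul_comm]
    congr 2
    have hpi' : (Real.pi : ℂ) ≠ 0 := by exact_mod_cast hpi
    push_cast
    field_simp
  have hneg : (-(Real.pi)⁻¹ : ℝ) ≠ 0 := neg_ne_zero.2 (inv_ne_zero hpi)
  have hpic : (1 / (Real.pi : ℂ)) ≠ 0 := by
    simp
  have hFi : Integrable (𝓕 f) := by
    have h := integrable_fockWigner_right m n x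
    simp only [funext hF] at h
    rw [integrable_const_mul_iff (isUnit_iff_ne_zero.2 hpic)] at h
    exact (integrable_comp_mul_left_iff _ hneg).1 h
  have hinv := congrFun (hfc.fourierInv_fourier_eq hfi hFi) 0
  rw [Real.fourierInv_eq'] at hinv
  simp only [inner_zero_right, mul_zero, Complex.ofReal_zero, zero_mul, Complex.exp_zero,
    one_smul] at hinv
  simp only [hF]
  rw [integral_const_mul, Measure.integral_comp_mul_left (𝓕 f), hinv]
  simp only [hf, add_zero, sub_zero, inv_neg, inv_inv, abs_neg, abs_of_pos Real.pi_pos,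
    Complex.real_smul]
  have hpi' : (Real.pi : ℂ) ≠ 0 := by exact_mod_cast hpi
  field_simp

section

/-! ### Coefficients -/

theorem psCoeff_eq (Λ T : ℝ) (n : ℕ) :
    psCoeff Λ T n = (1 - (T * Λ) ^ 2) ^ (3 / 2 : ℝ) / √((T * Λ) ^ 2 + 1) *
      (((n : ℝ) + 1) * (T * Λ) ^ n) := by
  simp only [psCoeff, mul_pow]
  ring

theorem summable_add_pow_mul_geometric (k : ℕ) {l : ℝ} (h0 : 0 ≤ l) (h1 : l < 1) :
    Summable (fun n : ℕ => ((n : ℝ) + 4) ^ k * l ^ n) := by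
  have hl : ‖l‖ < 1 := by rwa [Real.norm_of_nonneg h0]
  refine Summable.of_nonneg_of_le (fun n => by positivity) (fun n => ?_)
    (((summable_pow_mul_geometric_of_norm_lt_one k hl).mul_left (5 ^ k)).add
      ((summable_geometric_of_norm_lt_one hl).mul_left (4 ^ k)))
  rcases Nat.eq_zero_or_pos n with rfl | hn
  · simp
  · have hn' : (1 : ℝ) ≤ n := by exact_mod_cast hn
    have h : ((n : ℝ) + 4) ^ k ≤ 5 ^ k * (n : ℝ) ^ k := by
      rw [← mul_pow]
      exact pow_le_pow_left₀ (by positivity) (by linarith) k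
    have h2 : 0 ≤ (4 : ℝ) ^ k * l ^ n := by positivity
    have h3 := mul_le_mul_of_nonneg_right h (pow_nonneg h0 n)
    linarith

theorem hasSum_succ_mul_geometric {l : ℝ} (h0 : 0 ≤ l) (h1 : l < 1) :
    HasSum (fun n : ℕ => ((n : ℝ) + 1) * l ^ n) (1 / (1 - l) ^ 2) := by
  have hl : ‖l‖ < 1 := by rwa [Real.norm_of_nonneg h0]
  simpa using hasSum_choose_mul_geometric_of_norm_lt_one 1 hl

theorem hasSum_succ_sq_mul_geometric {l : ℝ} (h0 : 0 ≤ l) (h1 : l < 1) :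
    HasSum (fun n : ℕ => ((n : ℝ) + 1) ^ 2 * l ^ n) ((1 + l) / (1 - l) ^ 3) := by
  have hl : ‖l‖ < 1 := by rwa [Real.norm_of_nonneg h0]
  have h2 := (hasSum_choose_mul_geometric_of_norm_lt_one 2 hl).mul_left 2
  have h := h2.sub (hasSum_succ_mul_geometric h0 h1)
  have hne : 1 - l ≠ 0 := by linarith
  have hv : (1 + l) / (1 - l) ^ 3 = 2 * (1 / (1 - l) ^ (2 + 1)) - 1 / (1 - l) ^ 2 := by
    field_simp
    ring
  rw [hv]
  refine h.congr_fun fun n => ?_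
  rw [Nat.cast_choose_two]
  push_cast
  ring

variable {Λ T : ℝ}

theorem psCoeff_nonneg (h0 : 0 ≤ T * Λ) (h1 : T * Λ < 1) (n : ℕ) : 0 ≤ psCoeff Λ T n := by
  rw [psCoeff_eq]
  have : 0 ≤ 1 - (T * Λ) ^ 2 := by nlinarith
  positivity

theorem summable_add_pow_mul_psCoeff (k : ℕ) (h0 : 0 ≤ T * Λ) (h1 : T * Λ < 1) :
    Summable (fun n : ℕ => ((n : ℝ) + 4) ^ k * psCoeff Λ T n) := by
  refine Summable.of_nonneg_of_le
    (fun n => mul_nonneg (by positivity) (psCoeff_nonneg h0 h1 n)) (fun n => ?_)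
    ((summable_add_pow_mul_geometric (k + 1) h0 h1).mul_left
      ((1 - (T * Λ) ^ 2) ^ (3 / 2 : ℝ) / √((T * Λ) ^ 2 + 1)))
  have hq : 0 ≤ 1 - (T * Λ) ^ 2 := by nlinarith
  rw [psCoeff_eq, mul_left_comm]
  refine mul_le_mul_of_nonneg_left ?_ (by positivity)
  rw [pow_succ, mul_assoc]
  have : ((n : ℝ) + 1) * (T * Λ) ^ n ≤ ((n : ℝ) + 4) * (T * Λ) ^ n := by
    gcongr
    norm_num
  gcongr

theorem summable_psCoeff (h0 : 0 ≤ T * Λ) (h1 : T * Λ < 1) : Summable (psCoeff Λ T) := by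
  simpa using summable_add_pow_mul_psCoeff 0 h0 h1

theorem psPrefactor_sq (h0 : 0 ≤ T * Λ) (h1 : T * Λ < 1) :
    ((1 - (T * Λ) ^ 2) ^ (3 / 2 : ℝ) / √((T * Λ) ^ 2 + 1)) ^ 2 =
      (1 - (T * Λ) ^ 2) ^ 3 / ((T * Λ) ^ 2 + 1) := by
  have hq : 0 ≤ 1 - (T * Λ) ^ 2 := by nlinarith
  rw [div_pow, Real.sq_sqrt (by positivity), ← Real.rpow_natCast (_ ^ (3 / 2 : ℝ)),
    ← Real.rpow_mul hq]
  norm_num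

theorem hasSum_psCoeff_sq (h0 : 0 ≤ T * Λ) (h1 : T * Λ < 1) :
    HasSum (fun n => psCoeff Λ T n ^ 2) 1 := by
  have hl2 : (T * Λ) ^ 2 < 1 := by nlinarith
  have h := (hasSum_succ_sq_mul_geometric (sq_nonneg (T * Λ)) hl2).mul_left
    ((1 - (T * Λ) ^ 2) ^ 3 / ((T * Λ) ^ 2 + 1))
  have hne : 1 - (T * Λ) ^ 2 ≠ 0 := by linarith
  have hne' : (T * Λ) ^ 2 + 1 ≠ 0 := by positivity
  have hv : (1 - (T * Λ) ^ 2) ^ 3 / ((T * Λ) ^ 2 + 1) *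
      ((1 + (T * Λ) ^ 2) / (1 - (T * Λ) ^ 2) ^ 3) = 1 := by
    rw [div_mul_div_comm, add_comm 1, mul_comm]
    exact div_self (mul_ne_zero hne' (pow_ne_zero 3 hne))
  rw [hv] at h
  refine h.congr_fun fun n => ?_
  rw [psCoeff_eq, mul_pow, psPrefactor_sq h0 h1]
  ring

/-- This will be the trace norm of the partial transpose; squaring turns the half-integer powers of
the prefactor into rational functions. -/
theorem tsum_psCoeff_sq (h0 : 0 ≤ T * Λ) (h1 : T * Λ < 1) :
    (∑' n, psCoeff Λ T n) ^ 2 =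
      (1 + T * Λ) ^ 3 / ((1 + (T * Λ) ^ 2) * (1 - T * Λ)) := by
  have h := (hasSum_succ_mul_geometric h0 h1).mul_left
    ((1 - (T * Λ) ^ 2) ^ (3 / 2 : ℝ) / √((T * Λ) ^ 2 + 1))
  simp only [← psCoeff_eq] at h
  have hne : 1 - T * Λ ≠ 0 := by linarith
  have hne' : 1 + (T * Λ) ^ 2 ≠ 0 := by positivity
  rw [h.tsum_eq, mul_pow, psPrefactor_sq h0 h1, add_comm ((T * Λ) ^ 2) 1]
  generalize T * Λ = l at *
  field_simp
  ring

/-! ### The state vector -/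

theorem norm_ket (m n : ℕ) : ‖ket m n‖ = 1 := by
  simp [ket, lp.norm_single]

theorem inner_ket_left (m n : ℕ) (f : TwoMode) : inner ℂ (ket m n) f = f (m, n) := by
  rw [ket, lp.inner_single_left]
  simp

theorem ket_apply (m n : ℕ) (q : ℕ × ℕ) : ket m n q = if q = (m, n) then 1 else 0 := by
  rw [ket, lp.single_apply, Pi.single_apply]

/-- Bounded operators with the same Fock matrix elements are equal. -/
theorem ext_inner_ket {τ σ : TwoMode →L[ℂ] TwoMode}
    (h : ∀ m n k l : ℕ, inner ℂ (ket m n) (τ (ket k l)) = inner ℂ (ket m n) (σ (ket k l))) :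
    τ = σ := by
  let b : HilbertBasis (ℕ × ℕ) ℂ TwoMode := ⟨LinearIsometryEquiv.refl ℂ TwoMode⟩
  have hb : ∀ i, b i = ket i.1 i.2 := fun i => (b.repr_symm_single i).symm
  refine ContinuousLinearMap.ext_on (s := Set.range b)
    ((Submodule.dense_iff_topologicalClosure_eq_top).2 b.dense_span) ?_
  rintro _ ⟨i, rfl⟩
  apply b.repr.injective
  ext j
  simp only [b.repr_apply_apply, hb]
  exact h _ _ _ _

variable {r : ℝ}

theorem hasSum_psState (h0 : 0 ≤ T * Real.tanh r) (h1 : T * Real.tanh r < 1) :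
    HasSum (fun n : ℕ => (psCoeff (Real.tanh r) T n : ℂ) • ket n n) (psState r T) := by
  refine Summable.hasSum (Summable.of_norm ((summable_psCoeff h0 h1).congr fun n => ?_))
  rw [norm_smul, norm_ket, mul_one, Complex.norm_real,
    Real.norm_of_nonneg (psCoeff_nonneg h0 h1 n)]

theorem psState_apply (h0 : 0 ≤ T * Real.tanh r) (h1 : T * Real.tanh r < 1) (m n : ℕ) :
    psState r T (m, n) = if m = n then (psCoeff (Real.tanh r) T n : ℂ) else 0 := by
  have h := (hasSum_psState h0 h1).mapL (innerSL ℂ (ket m n))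
  simp only [map_smul, innerSL_apply_apply, inner_ket_left, ket_apply, Prod.mk.injEq,
    smul_eq_mul] at h
  refine h.unique ?_
  refine (hasSum_ite_eq n (if m = n then (psCoeff (Real.tanh r) T n : ℂ) else 0)).congr_fun
    fun k => ?_
  by_cases hk : n = k
  · subst hk
    by_cases hm : m = n <;> simp [hm]
  · simp [hk, Ne.symm hk]

theorem norm_psState (h0 : 0 ≤ T * Real.tanh r) (h1 : T * Real.tanh r < 1) :
    ‖psState r T‖ = 1 := by
  have h := (hasSum_psState h0 h1).mapL (innerSL ℂ (psState r T))
  have h2 : HasSum (fun n => ((psCoeff (Real.tanh r) T n ^ 2 : ℝ) : ℂ)) ((1 : ℝ) : ℂ) :=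
    Complex.hasSum_ofReal.2 (hasSum_psCoeff_sq h0 h1)
  have h3 := h.unique (h2.congr_fun fun n => ?_)
  · have h4 : ‖psState r T‖ ^ 2 = 1 := by
      rw [← inner_self_eq_norm_sq (𝕜 := ℂ), ← innerSL_apply_apply ℂ, h3]
      simp
    exact (pow_eq_one_iff_of_nonneg (norm_nonneg _) two_ne_zero).1 h4
  · rw [map_smul, innerSL_apply_apply, ← inner_conj_symm, inner_ket_left, psState_apply h0 h1]
    simp [sq]

/-! ### Partial transpose and negativity -/

/-- Product coefficient `c_m c_n`. -/
def psCoeff₂ (Λ T : ℝ) (q : ℕ × ℕ) : ℝ := psCoeff Λ T q.1 * psCoeff Λ T q.2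

theorem psCoeff₂_nonneg (h0 : 0 ≤ T * Λ) (h1 : T * Λ < 1) (q : ℕ × ℕ) :
    0 ≤ psCoeff₂ Λ T q :=
  mul_nonneg (psCoeff_nonneg h0 h1 _) (psCoeff_nonneg h0 h1 _)

theorem summable_psCoeff₂ (h0 : 0 ≤ T * Λ) (h1 : T * Λ < 1) : Summable (psCoeff₂ Λ T) :=
  (summable_psCoeff h0 h1).mul_of_nonneg (summable_psCoeff h0 h1)
    (psCoeff_nonneg h0 h1) (psCoeff_nonneg h0 h1)

theorem tsum_psCoeff₂ (h0 : 0 ≤ T * Λ) (h1 : T * Λ < 1) :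
    ∑' q, psCoeff₂ Λ T q = (∑' n, psCoeff Λ T n) ^ 2 := by
  rw [sq, (summable_psCoeff h0 h1).tsum_mul_tsum (summable_psCoeff h0 h1) (summable_psCoeff₂ h0 h1)]
  rfl

/-- `∑ c_m c_n |n,m⟩⟨m,n|`, the partial transpose of the photon-subtracted state. -/
def psSwap (Λ T : ℝ) : TwoMode →L[ℂ] TwoMode :=
  ∑' q : ℕ × ℕ, (psCoeff₂ Λ T q : ℂ) • InnerProductSpace.rankOne ℂ (ket q.2 q.1) (ket q.1 q.2)

/-- `∑ c_m c_n |m,n⟩⟨m,n|`, the absolute value of the partial transpose. -/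
def psDiag (Λ T : ℝ) : TwoMode →L[ℂ] TwoMode :=
  ∑' q : ℕ × ℕ, (psCoeff₂ Λ T q : ℂ) • InnerProductSpace.rankOne ℂ (ket q.1 q.2) (ket q.1 q.2)

theorem summable_smul_rankOne (h0 : 0 ≤ T * Λ) (h1 : T * Λ < 1) (a b c d : ℕ × ℕ → ℕ) :
    Summable (fun q : ℕ × ℕ => (psCoeff₂ Λ T q : ℂ) •
      InnerProductSpace.rankOne ℂ (ket (a q) (b q)) (ket (c q) (d q))) := by
  refine Summable.of_norm ((summable_psCoeff₂ h0 h1).congr fun q => ?_)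
  rw [norm_smul, InnerProductSpace.norm_rankOne, norm_ket, norm_ket, Complex.norm_real,
    Real.norm_of_nonneg (psCoeff₂_nonneg h0 h1 q)]
  ring

theorem tsum_smul_rankOne_ket (h0 : 0 ≤ T * Λ) (h1 : T * Λ < 1) (a b : ℕ × ℕ → ℕ) (k l : ℕ) :
    (∑' q : ℕ × ℕ, (psCoeff₂ Λ T q : ℂ) •
      InnerProductSpace.rankOne ℂ (ket (a q) (b q)) (ket q.1 q.2)) (ket k l) =
      (psCoeff₂ Λ T (k, l) : ℂ) • ket (a (k, l)) (b (k, l)) := by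
  have h := (summable_smul_rankOne h0 h1 a b Prod.fst Prod.snd).hasSum.mapL
    (ContinuousLinearMap.apply ℂ TwoMode (ket k l))
  refine h.unique ?_
  refine (hasSum_ite_eq (k, l)
    ((psCoeff₂ Λ T (k, l) : ℂ) • ket (a (k, l)) (b (k, l)))).congr_fun fun q => ?_
  simp only [ContinuousLinearMap.apply_apply, smul_apply,
    InnerProductSpace.rankOne_apply, inner_ket_left, ket_apply]
  split_ifs with hq
  · rw [Prod.mk.eta] at hq
    subst hq
    simp
  · simp

theorem psSwap_ket (h0 : 0 ≤ T * Λ) (h1 : T * Λ < 1) (k l : ℕ) :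
    psSwap Λ T (ket k l) = (psCoeff₂ Λ T (k, l) : ℂ) • ket l k :=
  tsum_smul_rankOne_ket h0 h1 Prod.snd Prod.fst k l

theorem psDiag_ket (h0 : 0 ≤ T * Λ) (h1 : T * Λ < 1) (k l : ℕ) :
    psDiag Λ T (ket k l) = (psCoeff₂ Λ T (k, l) : ℂ) • ket k l :=
  tsum_smul_rankOne_ket h0 h1 Prod.fst Prod.snd k l

theorem psDiag_nonneg (h0 : 0 ≤ T * Λ) (h1 : T * Λ < 1) : 0 ≤ psDiag Λ T := by
  refine tsum_nonneg fun q => ?_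
  rw [ContinuousLinearMap.nonneg_iff_isPositive]
  refine (InnerProductSpace.isPositive_rankOne_self _).smul_of_nonneg ?_
  exact_mod_cast psCoeff₂_nonneg h0 h1 q

/-- Exchanging the labels permutes the Fock basis, so `S†S = D²` for the swap form `S` and the
diagonal form `D`; as `D ≥ 0`, uniqueness of the positive square root applies. -/
theorem opAbs_psSwap (h0 : 0 ≤ T * Λ) (h1 : T * Λ < 1) : opAbs (psSwap Λ T) = psDiag Λ T := by
  have hD := psDiag_nonneg h0 h1
  have hDs : ContinuousLinearMap.adjoint (psDiag Λ T) = psDiag Λ T :=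
    (IsSelfAdjoint.of_nonneg hD).star_eq
  refine CFC.sqrt_unique ?_ hD
  refine ext_inner_ket fun m n k l => ?_
  rw [mul_apply_eq_comp, mul_apply_eq_comp,
    ContinuousLinearMap.star_eq_adjoint, ContinuousLinearMap.adjoint_inner_right]
  nth_rewrite 1 [← hDs]
  rw [ContinuousLinearMap.adjoint_inner_right]
  simp only [psSwap_ket h0 h1, psDiag_ket h0 h1, inner_smul_left, inner_smul_right, inner_ket_left,
    ket_apply, Prod.mk.injEq, and_comm]

theorem isPartialTranspose_psSwap (h0 : 0 ≤ T * Real.tanh r) (h1 : T * Real.tanh r < 1) :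
    IsPartialTranspose (density (psState r T)) (psSwap (Real.tanh r) T) := by
  intro m n k l
  rw [density, InnerProductSpace.rankOne_apply, psSwap_ket h0 h1, inner_smul_right,
    inner_smul_right, ← inner_conj_symm (psState r T), inner_ket_left, inner_ket_left,
    inner_ket_left, ket_apply, psState_apply h0 h1, psState_apply h0 h1]
  by_cases hk : k = n
  · by_cases hm : m = l
    · simp [hk, hm, psCoeff₂]
    · simp [hm]
  · simp [hk, Ne.symm hk]

theorem partialTranspose_psState (h0 : 0 ≤ T * Real.tanh r) (h1 : T * Real.tanh r < 1) :
    partialTranspose (density (psState r T)) = psSwap (Real.tanh r) T := by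
  have h : ∃ τ, IsPartialTranspose (density (psState r T)) τ :=
    ⟨_, isPartialTranspose_psSwap h0 h1⟩
  rw [partialTranspose, dif_pos h]
  exact h.choose_spec.unique (isPartialTranspose_psSwap h0 h1)

theorem traceNorm_psSwap (h0 : 0 ≤ T * Λ) (h1 : T * Λ < 1) :
    traceNorm (psSwap Λ T) = ENNReal.ofReal ((∑' n, psCoeff Λ T n) ^ 2) := by
  rw [traceNorm, opAbs_psSwap h0 h1, ← tsum_psCoeff₂ h0 h1,
    ENNReal.ofReal_tsum_of_nonneg (psCoeff₂_nonneg h0 h1) (summable_psCoeff₂ h0 h1)]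
  refine tsum_congr fun q => ?_
  rw [psDiag_ket h0 h1, inner_smul_right, inner_ket_left, ket_apply]
  simp

theorem negativity_psState (h0 : 0 ≤ T * Real.tanh r) (h1 : T * Real.tanh r < 1) :
    negativity (density (psState r T)) =
      2 / (1 - T * Real.tanh r) - 1 / (1 + T ^ 2 * Real.tanh r ^ 2) - 1 := by
  rw [negativity, partialTranspose_psState h0 h1, traceNorm_psSwap h0 h1,
    ENNReal.toReal_ofReal (sq_nonneg _), tsum_psCoeff_sq h0 h1, ← mul_pow]
  have hne : 1 - T * Real.tanh r ≠ 0 := by linarith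
  have hne' : 1 + (T * Real.tanh r) ^ 2 ≠ 0 := by positivity
  generalize T * Real.tanh r = l at *
  field_simp
  ring

end

section

/-! ### The Wigner function as a bounded form on `L²` -/

/-- Continuity in each slot gives the iterated sum; the assumed joint summability identifies it with
the double sum. -/
theorem hasSum_inner_prod {E : Type*} [NormedAddCommGroup E] [InnerProductSpace ℂ E]
    {f g : ℕ → E} {a b : E} (hf : HasSum f a) (hg : HasSum g b)
    (hs : Summable fun q : ℕ × ℕ => inner ℂ (f q.1) (g q.2)) :
    HasSum (fun q : ℕ × ℕ => inner ℂ (f q.1) (g q.2)) (inner ℂ a b) := by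
  have h1 : ∀ m, HasSum (fun n => inner ℂ (f m) (g n)) (inner ℂ (f m) b) := fun m =>
    hg.mapL (innerSL ℂ (f m))
  have h2 := hs.hasSum.prod_fiberwise h1
  have h3 : HasSum (fun m => inner ℂ (f m) b) (inner ℂ a b) := by
    simpa only [innerSL_apply_apply, ← starRingEnd_apply, inner_conj_symm] using
      (hf.mapL (innerSL ℂ b)).star
  rw [← h2.unique h3]
  exact hs.hasSum

/-- The phase `exp(2i(p_A u + p_B v))`. -/
def phase (pA pB : ℝ) (u : ℝ × ℝ) : ℂ :=
  Complex.exp (2 * Complex.I * ((pA * u.1 + pB * u.2 : ℝ) : ℂ))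

theorem memLp_phase (pA pB : ℝ) : MemLp (phase pA pB) ⊤ (volume : Measure (ℝ × ℝ)) := by
  refine memLp_top_of_bound (Continuous.aestronglyMeasurable ?_) 1
    (Filter.Eventually.of_forall fun u => (norm_exp_two_I_mul _).le)
  unfold phase
  fun_prop

/-- `Φ ↦ Φ(a + ·)` on `L²(ℝ²)`. -/
def shiftL (a : ℝ × ℝ) :
    Lp ℂ 2 (volume : Measure (ℝ × ℝ)) →L[ℂ] Lp ℂ 2 (volume : Measure (ℝ × ℝ)) :=
  (Lp.compMeasurePreservingₗᵢ ℂ (fun u : ℝ × ℝ => a + u)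
    (measurePreserving_add_left volume a)).toContinuousLinearMap

/-- `Φ ↦ exp(2i(p_A u + p_B v)) Φ(a - ·)` on `L²(ℝ²)`. -/
def reflectL (a : ℝ × ℝ) (pA pB : ℝ) :
    Lp ℂ 2 (volume : Measure (ℝ × ℝ)) →L[ℂ] Lp ℂ 2 (volume : Measure (ℝ × ℝ)) :=
  ((ContinuousLinearMap.mul ℂ ℂ).holderL volume ⊤ 2 2 (memLp_phase pA pB).toLp) ∘L
    (Lp.compMeasurePreservingₗᵢ ℂ (fun u : ℝ × ℝ => a - u)
      (Measure.measurePreserving_sub_left volume a)).toContinuousLinearMap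

theorem shiftL_ae (a : ℝ × ℝ) (Φ : Lp ℂ 2 (volume : Measure (ℝ × ℝ))) :
    shiftL a Φ =ᵐ[volume] fun u => Φ (a + u) :=
  Lp.coeFn_compMeasurePreserving Φ (measurePreserving_add_left volume a)

theorem reflectL_ae (a : ℝ × ℝ) (pA pB : ℝ) (Φ : Lp ℂ 2 (volume : Measure (ℝ × ℝ))) :
    reflectL a pA pB Φ =ᵐ[volume] fun u => phase pA pB u * Φ (a - u) := by
  have h1 := (ContinuousLinearMap.mul ℂ ℂ).coeFn_holder (r := 2) (memLp_phase pA pB).toLp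
    (Lp.compMeasurePreserving (fun u : ℝ × ℝ => a - u)
      (Measure.measurePreserving_sub_left volume a) Φ)
  filter_upwards [h1, (memLp_phase pA pB).coeFn_toLp,
    Lp.coeFn_compMeasurePreserving Φ (Measure.measurePreserving_sub_left volume a)] with u e1 e2 e3
  refine e1.trans ?_
  rw [e2, e3]
  rfl

theorem inner_shiftL_reflectL (a : ℝ × ℝ) (pA pB : ℝ)
    (Φ Ψ : Lp ℂ 2 (volume : Measure (ℝ × ℝ))) :
    inner ℂ (shiftL a Φ) (reflectL a pA pB Ψ) = ∫ u : ℝ × ℝ,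
      (starRingEnd ℂ) (Φ (a + u)) * Ψ (a - u) * phase pA pB u := by
  rw [L2.inner_def]
  refine integral_congr_ae ?_
  filter_upwards [shiftL_ae a Φ, reflectL_ae a pA pB Ψ] with u e1 e2
  rw [e1, e2, RCLike.inner_apply]
  ring

/-- With bounded operators in place of point evaluations, an `L²`-convergent expansion can be
inserted at every phase-space point, not just almost everywhere. -/
theorem wigner_eq_inner (ψ : TwoMode) (xA pA xB pB : ℝ) :
    wigner ψ xA pA xB pB = ((1 / (Real.pi : ℂ) ^ 2) *
      inner ℂ (shiftL (xA, xB) (waveFunction ψ)) (reflectL (xA, xB) pA pB (waveFunction ψ))).re := by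
  rw [inner_shiftL_reflectL]
  rfl

theorem fockL2_ae (m n : ℕ) : fockL2 m n =ᵐ[volume] fockWave m n :=
  (memLp_fockWave m n).coeFn_toLp

/-- The integrand is a product over the modes, and twin Fock states give both modes the same index
pair. -/
theorem inner_shiftL_reflectL_fockL2 (m n : ℕ) (xA pA xB pB : ℝ) :
    inner ℂ (shiftL (xA, xB) (fockL2 m m)) (reflectL (xA, xB) pA pB (fockL2 n n)) =
      (Real.pi : ℂ) ^ 2 * (fockWigner m n xA pA * fockWigner m n xB pB) := by
  have hpi : (Real.pi : ℂ) ≠ 0 := by exact_mod_cast Real.pi_ne_zero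
  have e1 := (measurePreserving_add_left volume (xA, xB)).quasiMeasurePreserving.ae_eq_comp
    (fockL2_ae m m)
  have e2 := (Measure.measurePreserving_sub_left volume (xA, xB)).quasiMeasurePreserving.ae_eq_comp
    (fockL2_ae n n)
  have h : ∫ u : ℝ × ℝ, (starRingEnd ℂ) (fockL2 m m ((xA, xB) + u)) * fockL2 n n ((xA, xB) - u) *
      phase pA pB u = ∫ u : ℝ × ℝ, fockWignerIntegrand m n xA pA u.1 *
        fockWignerIntegrand m n xB pB u.2 := by
    refine integral_congr_ae ?_
    filter_upwards [e1, e2] with u h1 h2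
    simp only [Function.comp] at h1 h2
    rw [h1, h2]
    have he : phase pA pB u = Complex.exp (2 * Complex.I * ((pA * u.1 : ℝ) : ℂ)) *
        Complex.exp (2 * Complex.I * ((pB * u.2 : ℝ) : ℂ)) := by
      rw [phase, ← Complex.exp_add]
      congr 1
      push_cast
      ring
    simp only [fockWave, fockWignerIntegrand, he, Complex.conj_ofReal, Prod.fst_add, Prod.snd_add,
      Prod.fst_sub, Prod.snd_sub]
    push_cast
    ring
  rw [inner_shiftL_reflectL, h]
  refine (integral_prod_mul (μ := volume) (ν := volume) (fockWignerIntegrand m n xA pA)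
    (fockWignerIntegrand m n xB pB)).trans ?_
  simp only [fockWigner]
  field_simp

theorem norm_fockL2 (m n : ℕ) : ‖fockL2 m n‖ = 1 := by
  have h : inner ℂ (fockL2 m n) (fockL2 m n) = (1 : ℂ) := by
    have h1 : ∫ q : ℝ × ℝ, inner ℂ (fockL2 m n q) (fockL2 m n q) =
        ∫ q : ℝ × ℝ, (((hermiteFun m q.1 ^ 2) * (hermiteFun n q.2 ^ 2) : ℝ) : ℂ) := by
      refine integral_congr_ae ?_
      filter_upwards [fockL2_ae m n] with q hq
      rw [hq, fockWave, RCLike.inner_apply, Complex.conj_ofReal]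
      push_cast
      ring
    rw [L2.inner_def, h1, integral_complex_ofReal]
    have h2 := integral_prod_mul (μ := (volume : Measure ℝ)) (ν := (volume : Measure ℝ))
      (fun x => hermiteFun m x ^ 2) (fun x => hermiteFun n x ^ 2)
    rw [integral_hermiteFun_sq, integral_hermiteFun_sq] at h2
    rw [Measure.volume_eq_prod, h2]
    simp
  have h4 : ‖fockL2 m n‖ ^ 2 = 1 := by
    rw [← inner_self_eq_norm_sq (𝕜 := ℂ), h]
    simp
  exact (pow_eq_one_iff_of_nonneg (norm_nonneg _) two_ne_zero).1 h4

variable {r T : ℝ}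

theorem hasSum_waveFunction (h0 : 0 ≤ T * Real.tanh r) (h1 : T * Real.tanh r < 1) :
    HasSum (fun n : ℕ => (psCoeff (Real.tanh r) T n : ℂ) • fockL2 n n)
      (waveFunction (psState r T)) := by
  have hs : Summable (fun n : ℕ => (psCoeff (Real.tanh r) T n : ℂ) • fockL2 n n) := by
    refine Summable.of_norm ((summable_psCoeff h0 h1).congr fun n => ?_)
    rw [norm_smul, norm_fockL2, mul_one, Complex.norm_real,
      Real.norm_of_nonneg (psCoeff_nonneg h0 h1 n)]
  have hinj : Function.Injective (fun n : ℕ => (n, n)) := fun a b h => (Prod.ext_iff.1 h).1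
  -- The double series over `ℕ × ℕ` is supported on the diagonal.
  have h := hinj.tsum_eq (f := fun q : ℕ × ℕ => psState r T q • fockL2 q.1 q.2) ?_
  · rw [waveFunction, ← h]
    simpa [psState_apply h0 h1] using hs.hasSum
  · intro q hq
    by_cases hq' : q.1 = q.2
    · exact ⟨q.1, Prod.ext rfl hq'⟩
    · refine absurd ?_ hq
      have := psState_apply h0 h1 q.1 q.2
      rw [if_neg hq'] at this
      simp [this]

theorem summable_of_abs_le_psCoeff₂ (h0 : 0 ≤ T * Real.tanh r) (h1 : T * Real.tanh r < 1)
    {E : Type*} [NormedAddCommGroup E] [CompleteSpace E] {f : ℕ × ℕ → E}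
    (hf : ∀ q, ‖f q‖ ≤ psCoeff₂ (Real.tanh r) T q) : Summable f :=
  Summable.of_norm_bounded (summable_psCoeff₂ h0 h1) hf

theorem hasSum_wigner (h0 : 0 ≤ T * Real.tanh r) (h1 : T * Real.tanh r < 1) (xA pA xB pB : ℝ) :
    HasSum (fun q : ℕ × ℕ => psCoeff₂ (Real.tanh r) T q *
      (fockWigner q.1 q.2 xA pA * fockWigner q.1 q.2 xB pB).re)
      (wigner (psState r T) xA pA xB pB) := by
  have hpi : (Real.pi : ℂ) ≠ 0 := by exact_mod_cast Real.pi_ne_zero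
  have hw := hasSum_waveFunction h0 h1
  have hA := hw.mapL (shiftL (xA, xB))
  have hB := hw.mapL (reflectL (xA, xB) pA pB)
  have ht : ∀ q : ℕ × ℕ, inner ℂ (shiftL (xA, xB) ((psCoeff (Real.tanh r) T q.1 : ℂ) •
      fockL2 q.1 q.1)) (reflectL (xA, xB) pA pB ((psCoeff (Real.tanh r) T q.2 : ℂ) •
        fockL2 q.2 q.2)) = (Real.pi : ℂ) ^ 2 * ((psCoeff₂ (Real.tanh r) T q : ℂ) *
          (fockWigner q.1 q.2 xA pA * fockWigner q.1 q.2 xB pB)) := by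
    intro q
    rw [map_smul, map_smul, inner_smul_left, inner_smul_right, inner_shiftL_reflectL_fockL2,
      Complex.conj_ofReal, psCoeff₂]
    push_cast
    ring
  have hs : Summable fun q : ℕ × ℕ => (psCoeff₂ (Real.tanh r) T q : ℂ) *
      (fockWigner q.1 q.2 xA pA * fockWigner q.1 q.2 xB pB) := by
    refine summable_of_abs_le_psCoeff₂ h0 h1 fun q => ?_
    rw [norm_mul, norm_mul, Complex.norm_real, Real.norm_of_nonneg (psCoeff₂_nonneg h0 h1 q)]
    exact mul_le_of_le_one_right (psCoeff₂_nonneg h0 h1 q)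
      (mul_le_one₀ (norm_fockWigner_le _ _ _ _) (norm_nonneg _) (norm_fockWigner_le _ _ _ _))
  have h := hasSum_inner_prod hA hB ((hs.mul_left ((Real.pi : ℂ) ^ 2)).congr fun q => (ht q).symm)
  have h2 := (h.congr_fun fun q => (ht q).symm).mul_left (1 / (Real.pi : ℂ) ^ 2)
  have h3 := h2.mapL Complex.reCLM
  rw [wigner_eq_inner]
  refine h3.congr_fun fun q => ?_
  rw [Complex.reCLM_apply, ← mul_assoc, one_div, inv_mul_cancel₀ (pow_ne_zero 2 hpi), one_mul,
    Complex.re_ofReal_mul]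

end

/-! ### Integrability of the Wigner function and rotated marginals -/

section

variable {r T : ℝ}

/-- Coefficients of the integrable bound of the Wigner series. -/
def wignerBound (Λ T : ℝ) (q : ℕ × ℕ) : ℝ :=
  psCoeff₂ Λ T q * (4 * ((q.1 : ℝ) + q.2 + 4) ^ 4) ^ 2

theorem wignerBound_nonneg {Λ : ℝ} (h0 : 0 ≤ T * Λ) (h1 : T * Λ < 1) (q : ℕ × ℕ) :
    0 ≤ wignerBound Λ T q :=
  mul_nonneg (psCoeff₂_nonneg h0 h1 q) (by positivity)

theorem summable_wignerBound {Λ : ℝ} (h0 : 0 ≤ T * Λ) (h1 : T * Λ < 1) :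
    Summable (wignerBound Λ T) := by
  have hs := summable_add_pow_mul_psCoeff 8 h0 h1
  have hnn : ∀ n : ℕ, 0 ≤ ((n : ℝ) + 4) ^ 8 * psCoeff Λ T n := fun n =>
    mul_nonneg (by positivity) (psCoeff_nonneg h0 h1 n)
  refine Summable.of_nonneg_of_le (wignerBound_nonneg h0 h1) (fun q => ?_)
    ((hs.mul_of_nonneg hs hnn hnn).mul_left 16)
  -- `m + n + 4 ≤ (m + 4)(n + 4)` separates the indices, so the majorant is a product of two single
  -- series. The exponent `8` and the factor `16` come from squaring the single-mode bound.
  have h : ((q.1 : ℝ) + q.2 + 4) ^ 8 ≤ (((q.1 : ℝ) + 4) * ((q.2 : ℝ) + 4)) ^ 8 := by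
    refine pow_le_pow_left₀ (by positivity) ?_ 8
    have h1 : (0 : ℝ) ≤ q.1 := by positivity
    have h2 : (0 : ℝ) ≤ q.2 := by positivity
    nlinarith
  calc wignerBound Λ T q = 16 * (psCoeff₂ Λ T q * ((q.1 : ℝ) + q.2 + 4) ^ 8) := by
        rw [wignerBound]
        ring
    _ ≤ 16 * (psCoeff₂ Λ T q * (((q.1 : ℝ) + 4) * ((q.2 : ℝ) + 4)) ^ 8) := by
        have := mul_le_mul_of_nonneg_left h (psCoeff₂_nonneg h0 h1 q)
        linarith
    _ = _ := by
        rw [psCoeff₂]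
        ring

/-- Only moduli enter, so the same bound covers the terms of the Wigner series and their rotated
versions. -/
theorem norm_psCoeff₂_mul_le {Λ : ℝ} (h0 : 0 ≤ T * Λ) (h1 : T * Λ < 1) (q : ℕ × ℕ) {z w : ℂ}
    {x p y s : ℝ} (hz : ‖z‖ = ‖fockWigner q.1 q.2 x p‖) (hw : ‖w‖ = ‖fockWigner q.1 q.2 y s‖) :
    ‖psCoeff₂ Λ T q * (z * w).re‖ ≤ wignerBound Λ T q * (phaseWeight x p * phaseWeight y s) := by
  have hp := phaseWeight_nonneg x p
  have hs := phaseWeight_nonneg y s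
  have ha := norm_fockWigner_le_phaseWeight q.1 q.2 x p
  have hb := norm_fockWigner_le_phaseWeight q.1 q.2 y s
  rw [← hz] at ha
  rw [← hw] at hb
  rw [norm_mul, Real.norm_of_nonneg (psCoeff₂_nonneg h0 h1 q), wignerBound, mul_assoc]
  refine mul_le_mul_of_nonneg_left ?_ (psCoeff₂_nonneg h0 h1 q)
  calc ‖(z * w).re‖ ≤ ‖z * w‖ := Complex.abs_re_le_norm _
    _ = ‖z‖ * ‖w‖ := norm_mul _ _
    _ ≤ (4 * ((q.1 : ℝ) + q.2 + 4) ^ 4 * phaseWeight x p) *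
        (4 * ((q.1 : ℝ) + q.2 + 4) ^ 4 * phaseWeight y s) :=
      mul_le_mul ha hb (norm_nonneg _) (by positivity)
    _ = _ := by ring

/-- Uniform convergence of the series gives continuity, hence measurability; the weights give an
integrable majorant. -/
theorem integrable_wigner (h0 : 0 ≤ T * Real.tanh r) (h1 : T * Real.tanh r < 1) :
    Integrable (fun ξ : ℝ × ℝ × ℝ × ℝ => wigner (psState r T) ξ.1 ξ.2.1 ξ.2.2.1 ξ.2.2.2) := by
  have hG : Integrable (fun ξ : ℝ × ℝ × ℝ × ℝ =>
      phaseWeight ξ.1 ξ.2.1 * phaseWeight ξ.2.2.1 ξ.2.2.2) := by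
    refine (integrable_inv_one_add_sq.mul_prod (integrable_inv_one_add_sq.mul_prod
      integrable_phaseWeight)).congr (Filter.Eventually.of_forall fun ξ => ?_)
    simp only [phaseWeight]
    ring
  have hc : Continuous (fun ξ : ℝ × ℝ × ℝ × ℝ =>
      wigner (psState r T) ξ.1 ξ.2.1 ξ.2.2.1 ξ.2.2.2) := by
    simp only [← (hasSum_wigner h0 h1 _ _ _ _).tsum_eq]
    refine continuous_tsum (fun q => ?_) (summable_psCoeff₂ h0 h1) fun q ξ => ?_
    · have hA := (continuous_fockWigner q.1 q.2).comp
        (by fun_prop : Continuous fun ξ : ℝ × ℝ × ℝ × ℝ => (ξ.1, ξ.2.1))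
      have hB := (continuous_fockWigner q.1 q.2).comp
        (by fun_prop : Continuous fun ξ : ℝ × ℝ × ℝ × ℝ => (ξ.2.2.1, ξ.2.2.2))
      exact continuous_const.mul (Complex.continuous_re.comp (hA.mul hB))
    · rw [norm_mul, Real.norm_of_nonneg (psCoeff₂_nonneg h0 h1 q)]
      refine mul_le_of_le_one_right (psCoeff₂_nonneg h0 h1 q)
        ((Complex.abs_re_le_norm _).trans ?_)
      rw [norm_mul]
      exact mul_le_one₀ (norm_fockWigner_le _ _ _ _) (norm_nonneg _) (norm_fockWigner_le _ _ _ _)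
  refine (hG.const_mul (∑' q, wignerBound (Real.tanh r) T q)).mono' hc.aestronglyMeasurable
    (Filter.Eventually.of_forall fun ξ => ?_)
  rw [← (hasSum_wigner h0 h1 _ _ _ _).tsum_eq, ← tsum_mul_right]
  exact tsum_of_norm_bounded ((summable_wignerBound h0 h1).mul_right _).hasSum
    fun q => norm_psCoeff₂_mul_le h0 h1 q rfl rfl

/-- The phase acquired by the term `(m, n)` under the rotation of one mode by `θ`. -/
def rotPhase (q : ℕ × ℕ) (θ : ℝ) : ℂ :=
  Complex.exp (-(θ * Complex.I)) ^ q.1 * Complex.exp (θ * Complex.I) ^ q.2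

theorem rotPhase_mul_re (q : ℕ × ℕ) (θ φ : ℝ) :
    (rotPhase q θ * rotPhase q φ).re = Real.cos (((q.2 : ℝ) - q.1) * (θ + φ)) := by
  have h : rotPhase q θ * rotPhase q φ =
      Complex.exp (((((q.2 : ℝ) - q.1) * (θ + φ) : ℝ) : ℂ) * Complex.I) := by
    simp only [rotPhase, ← Complex.exp_nat_mul, ← Complex.exp_add]
    congr 1
    push_cast
    ring
  rw [h, Complex.exp_ofReal_mul_I_re]

/-- The marginal distribution as a sum over pairs of Fock states. -/
theorem hasSum_marginal (h0 : 0 ≤ T * Real.tanh r) (h1 : T * Real.tanh r < 1) (θ φ x y : ℝ) :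
    HasSum (fun q : ℕ × ℕ => psCoeff₂ (Real.tanh r) T q *
      Real.cos (((q.2 : ℝ) - q.1) * (θ + φ)) *
        ((hermiteFun q.1 x * hermiteFun q.2 x) * (hermiteFun q.1 y * hermiteFun q.2 y)))
      (marginal (psState r T) θ φ x y) := by
  have hG : Integrable (fun p : ℝ × ℝ => phaseWeight x p.1 * phaseWeight y p.2) :=
    (integrable_phaseWeight_right x).mul_prod (integrable_phaseWeight_right y)
  have hW : ∀ q : ℕ × ℕ, Integrable (fun p : ℝ × ℝ => (rotPhase q θ * rotPhase q φ) *
      (fockWigner q.1 q.2 x p.1 * fockWigner q.1 q.2 y p.2)) := fun q =>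
    ((integrable_fockWigner_right q.1 q.2 x).mul_prod
      (integrable_fockWigner_right q.1 q.2 y)).const_mul _
  set F : ℕ × ℕ → ℝ × ℝ → ℝ := fun q p => psCoeff₂ (Real.tanh r) T q *
    (fockWigner q.1 q.2 (Real.cos θ * x + Real.sin θ * p.1) (-Real.sin θ * x + Real.cos θ * p.1) *
      fockWigner q.1 q.2 (Real.cos φ * y + Real.sin φ * p.2)
        (-Real.sin φ * y + Real.cos φ * p.2)).re with hF
  have hFe : ∀ q p, F q p = psCoeff₂ (Real.tanh r) T q * ((rotPhase q θ * rotPhase q φ) *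
      (fockWigner q.1 q.2 x p.1 * fockWigner q.1 q.2 y p.2)).re := by
    intro q p
    simp only [hF, fockWigner_rotate, rotPhase]
    congr 2
    ring
  -- Rotations preserve the modulus of each cross Wigner function, so the majorant can be taken in
  -- the unrotated variables.
  have h := hasSum_integral_of_dominated_convergence
    (μ := (volume : Measure (ℝ × ℝ))) (F := F) (f := fun p : ℝ × ℝ => wigner (psState r T)
      (Real.cos θ * x + Real.sin θ * p.1) (-Real.sin θ * x + Real.cos θ * p.1)
      (Real.cos φ * y + Real.sin φ * p.2) (-Real.sin φ * y + Real.cos φ * p.2))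
    (fun q p => wignerBound (Real.tanh r) T q * (phaseWeight x p.1 * phaseWeight y p.2))
    (fun q => ?_) (fun q => Filter.Eventually.of_forall fun p => ?_)
    (Filter.Eventually.of_forall fun p => (summable_wignerBound h0 h1).mul_right _) ?_
    (Filter.Eventually.of_forall fun p => hasSum_wigner h0 h1 _ _ _ _)
  · refine h.congr_fun fun q => ?_
    simp only [hFe]
    rw [integral_const_mul]
    have hre := integral_re (hW q)
    simp only [RCLike.re_to_complex] at hre
    rw [hre, integral_const_mul, Measure.volume_eq_prod, integral_prod_mul,
      integral_fockWigner_right, integral_fockWigner_right, ← Complex.ofReal_mul,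
      Complex.re_mul_ofReal, rotPhase_mul_re]
    ring
  · rw [funext (hFe q)]
    exact ((hW q).re.const_mul _).aestronglyMeasurable
  · exact norm_psCoeff₂_mul_le h0 h1 q (norm_fockWigner_rotate _ _ _ _ _)
      (norm_fockWigner_rotate _ _ _ _ _)
  · simp only [tsum_mul_right]
    exact hG.const_mul _

/-! ### Sign-binned correlations -/

/-- `∫ sgn(x) h_m(x) h_n(x) dx`. -/
def signOverlap (m n : ℕ) : ℝ := ∫ x : ℝ, Real.sign x * (hermiteFun m x * hermiteFun n x)

theorem abs_sign_le_one (x : ℝ) : |Real.sign x| ≤ 1 := by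
  rcases Real.sign_apply_eq x with h | h | h <;> simp [h]

theorem sign_mul_eq (x y : ℝ) : Real.sign (x * y) = Real.sign x * Real.sign y := by
  rcases lt_trichotomy x 0 with hx | rfl | hx <;> rcases lt_trichotomy y 0 with hy | rfl | hy <;>
    simp [Real.sign_of_neg, Real.sign_of_pos, mul_pos_of_neg_of_neg, mul_neg_of_neg_of_pos,
      mul_neg_of_pos_of_neg, *]

theorem measurable_real_sign : Measurable Real.sign := by
  unfold Real.sign
  exact Measurable.ite measurableSet_Iio measurable_const
    (Measurable.ite measurableSet_Ioi measurable_const measurable_const)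

theorem integrable_sign_mul (m n : ℕ) :
    Integrable (fun x : ℝ => Real.sign x * (hermiteFun m x * hermiteFun n x)) :=
  (integrable_hermiteFun_mul m n).bdd_mul (c := 1) measurable_real_sign.aestronglyMeasurable
    (Filter.Eventually.of_forall abs_sign_le_one)

/-- By parity, `|h_m h_n|` is the modulus of the cross Wigner integrand at the origin, whose
integral is already bounded. -/
theorem integral_norm_sign_mul_le (m n : ℕ) :
    ∫ x : ℝ, ‖Real.sign x * (hermiteFun m x * hermiteFun n x)‖ ≤ 1 := by
  refine le_trans ?_ (integral_norm_fockWignerIntegrand_le m n 0 0)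
  refine integral_mono (integrable_sign_mul m n).norm
    (integrable_fockWignerIntegrand m n 0 0).norm fun x => ?_
  simp only [fockWignerIntegrand, norm_mul, norm_exp_two_I_mul, mul_one, Complex.norm_real,
    zero_add, zero_sub, hermiteFun_neg, norm_pow, norm_neg, norm_one, one_pow, one_mul]
  exact mul_le_of_le_one_left (by positivity) (abs_sign_le_one x)

/-- Both the sign and each term of the marginal factor over `x` and `y`, and the two factors have
equal integrals; this produces the square, hence the nonnegative weight. -/
theorem hasSum_signCorr (h0 : 0 ≤ T * Real.tanh r) (h1 : T * Real.tanh r < 1) (θ φ : ℝ) :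
    HasSum (fun q : ℕ × ℕ => psCoeff₂ (Real.tanh r) T q *
      Real.cos (((q.2 : ℝ) - q.1) * (θ + φ)) * signOverlap q.1 q.2 ^ 2)
      (signCorr (psState r T) θ φ) := by
  set g : ℕ × ℕ → ℝ → ℝ := fun q x => Real.sign x * (hermiteFun q.1 x * hermiteFun q.2 x) with hg
  set C : ℕ × ℕ → ℝ := fun q => psCoeff₂ (Real.tanh r) T q *
    Real.cos (((q.2 : ℝ) - q.1) * (θ + φ)) with hC
  have hint : ∀ q, Integrable (fun p : ℝ × ℝ => C q * (g q p.1 * g q p.2)) := fun q =>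
    ((integrable_sign_mul q.1 q.2).mul_prod (integrable_sign_mul q.1 q.2)).const_mul _
  have hCle : ∀ q, ‖C q‖ ≤ psCoeff₂ (Real.tanh r) T q := by
    intro q
    rw [hC, norm_mul, Real.norm_of_nonneg (psCoeff₂_nonneg h0 h1 q)]
    exact mul_le_of_le_one_right (psCoeff₂_nonneg h0 h1 q) (Real.abs_cos_le_one _)
  have hnorm : Summable fun q => ∫ p : ℝ × ℝ, ‖C q * (g q p.1 * g q p.2)‖ := by
    refine Summable.of_nonneg_of_le (fun q => integral_nonneg fun _ => norm_nonneg _)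
      (fun q => ?_) (summable_psCoeff₂ h0 h1)
    simp only [norm_mul (C q), norm_mul (g q _)]
    have hp := integral_prod_mul (μ := (volume : Measure ℝ)) (ν := (volume : Measure ℝ))
      (fun x => ‖g q x‖) (fun x => ‖g q x‖)
    rw [integral_const_mul, Measure.volume_eq_prod, hp]
    have hle := integral_norm_sign_mul_le q.1 q.2
    have hnn : 0 ≤ ∫ x, ‖g q x‖ := integral_nonneg fun _ => norm_nonneg _
    calc ‖C q‖ * ((∫ x, ‖g q x‖) * ∫ x, ‖g q x‖) ≤ ‖C q‖ * 1 :=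
          mul_le_mul_of_nonneg_left (mul_le_one₀ hle hnn hle) (norm_nonneg _)
      _ ≤ _ := by
          rw [mul_one]
          exact hCle q
  have h := hasSum_integral_of_summable_integral_norm hint hnorm
  have hsum : ∀ p : ℝ × ℝ, ∑' q, C q * (g q p.1 * g q p.2) =
      Real.sign (p.1 * p.2) * marginal (psState r T) θ φ p.1 p.2 := by
    intro p
    rw [← (hasSum_marginal h0 h1 θ φ p.1 p.2).tsum_eq, ← tsum_mul_left]
    refine tsum_congr fun q => ?_
    rw [sign_mul_eq]
    simp only [hC, hg]
    ring
  simp only [hsum] at h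
  refine h.congr_fun fun q => ?_
  rw [integral_const_mul, Measure.volume_eq_prod, integral_prod_mul, sq]
  rfl

theorem signOverlap_comm (m n : ℕ) : signOverlap m n = signOverlap n m := by
  simp only [signOverlap, mul_comm (hermiteFun m _)]

theorem signOverlap_self (n : ℕ) : signOverlap n n = 0 := by
  have h := integral_neg_eq_self (fun x : ℝ => Real.sign x * (hermiteFun n x * hermiteFun n x))
    volume
  have h2 : ∀ x : ℝ, Real.sign (-x) * (hermiteFun n (-x) * hermiteFun n (-x)) =
      -(Real.sign x * (hermiteFun n x * hermiteFun n x)) := by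
    intro x
    have e : ((-1 : ℝ) ^ n) * (-1) ^ n = 1 := by
      rw [← mul_pow]
      simp
    rw [hermiteFun_neg, Real.sign_neg]
    linear_combination (-Real.sign x * hermiteFun n x * hermiteFun n x) * e
  simp only [h2] at h
  rw [integral_neg] at h
  simp only [signOverlap]
  linarith

theorem hasSum_signCorr_zero (h0 : 0 ≤ T * Real.tanh r) (h1 : T * Real.tanh r < 1) :
    HasSum (fun q : ℕ × ℕ => psCoeff₂ (Real.tanh r) T q * signOverlap q.1 q.2 ^ 2)
      (signCorr (psState r T) 0 0) := by
  simpa using hasSum_signCorr h0 h1 0 0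

/-- With nonnegative weights, the sum is largest in absolute value when every cosine equals `1`. -/
theorem abs_signCorr_le (h0 : 0 ≤ T * Real.tanh r) (h1 : T * Real.tanh r < 1) (θ φ : ℝ) :
    |signCorr (psState r T) θ φ| ≤ signCorr (psState r T) 0 0 := by
  rw [← (hasSum_signCorr h0 h1 θ φ).tsum_eq, ← Real.norm_eq_abs]
  refine tsum_of_norm_bounded (hasSum_signCorr_zero h0 h1) fun q => ?_
  rw [norm_mul, norm_mul, Real.norm_of_nonneg (psCoeff₂_nonneg h0 h1 q),
    Real.norm_of_nonneg (sq_nonneg _)]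
  refine mul_le_mul_of_nonneg_right ?_ (sq_nonneg _)
  exact mul_le_of_le_one_right (psCoeff₂_nonneg h0 h1 q) (Real.abs_cos_le_one _)

theorem isLUB_abs_signCorr (h0 : 0 ≤ T * Real.tanh r) (h1 : T * Real.tanh r < 1) :
    IsLUB (Set.range fun a : ℝ × ℝ => |signCorr (psState r T) a.1 a.2|)
      (signCorr (psState r T) 0 0) := by
  refine ⟨?_, fun b hb => ?_⟩
  · rintro _ ⟨a, rfl⟩
    exact abs_signCorr_le h0 h1 a.1 a.2
  · have h : |signCorr (psState r T) 0 0| ≤ b := hb ⟨(0, 0), rfl⟩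
    exact (le_abs_self _).trans h

theorem bitCorr_eq (h0 : 0 ≤ T * Real.tanh r) (h1 : T * Real.tanh r < 1) :
    bitCorr (psState r T) = signCorr (psState r T) 0 0 :=
  (isLUB_abs_signCorr h0 h1).csSup_eq (Set.range_nonempty _)

/-- The summand is symmetric in `m, n` and vanishes for `m = n`, so the full sum is twice the part
with `m < n`. -/
theorem hasSum_bitCorr (h0 : 0 ≤ T * Real.tanh r) (h1 : T * Real.tanh r < 1) :
    HasSum (fun p : {p : ℕ × ℕ // p.1 < p.2} =>
      2 * psCoeff₂ (Real.tanh r) T p.1 * signOverlap p.1.1 p.1.2 ^ 2) (bitCorr (psState r T)) := by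
  rw [bitCorr_eq h0 h1]
  set f : ℕ × ℕ → ℝ := fun q => psCoeff₂ (Real.tanh r) T q * signOverlap q.1 q.2 ^ 2 with hf
  have hall : HasSum f (signCorr (psState r T) 0 0) := hasSum_signCorr_zero h0 h1
  have hswap : ∀ q : ℕ × ℕ, f q.swap = f q := by
    intro q
    simp only [hf, psCoeff₂, Prod.fst_swap, Prod.snd_swap, signOverlap_comm q.2 q.1]
    ring
  have hdiag : ∀ q : ℕ × ℕ, q.1 = q.2 → f q = 0 := by
    intro q hq
    simp only [hf, hq, signOverlap_self]
    ring
  set s : Set (ℕ × ℕ) := {q | q.1 < q.2} with hs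
  set t : Set (ℕ × ℕ) := {q | q.2 < q.1} with ht
  have hst : ∀ q, s.indicator f q + t.indicator f q = f q := by
    intro q
    rcases lt_trichotomy q.1 q.2 with h | h | h
    · rw [Set.indicator_of_mem (show q ∈ s from h),
        Set.indicator_of_notMem (show q ∉ t from h.asymm), add_zero]
    · rw [Set.indicator_of_notMem (show q ∉ s from h.not_lt),
        Set.indicator_of_notMem (show q ∉ t from h.not_gt), hdiag q h, add_zero]
    · rw [Set.indicator_of_notMem (show q ∉ s from h.asymm),
        Set.indicator_of_mem (show q ∈ t from h), zero_add]
  have hS := (hall.summable.indicator s).hasSum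
  have hT : HasSum (t.indicator f) (∑' q, s.indicator f q) := by
    refine ((Equiv.prodComm ℕ ℕ).hasSum_iff.1 ?_)
    refine hS.congr_fun fun q => ?_
    by_cases hq : q.1 < q.2
    · rw [Set.indicator_of_mem (show q ∈ s from hq), Function.comp,
        Set.indicator_of_mem (show Equiv.prodComm ℕ ℕ q ∈ t from hq)]
      exact hswap q
    · rw [Set.indicator_of_notMem (show q ∉ s from hq), Function.comp,
        Set.indicator_of_notMem (show Equiv.prodComm ℕ ℕ q ∉ t from hq)]
  have htot := hall.unique ((hS.add hT).congr_fun fun q => (hst q).symm)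
  have h2 := (hasSum_subtype_iff_indicator.2 hS).mul_left 2
  rw [htot, ← two_mul]
  refine h2.congr_fun fun p => ?_
  simp only [hf, Function.comp]
  ring

end

/-! ### Evaluation of the overlaps -/

/-- The oscillator equation `h'' = (x² - (2n+1)) h`, obtained by applying both ladder operators in
succession. -/
theorem hasDerivAt_hermiteDeriv (n : ℕ) (x : ℝ) :
    HasDerivAt (hermiteDeriv n) ((x ^ 2 - (2 * n + 1)) * hermiteFun n x) x := by
  have h := ((hasDerivAt_hermiteFun (n - 1) x).const_mul (√2 * √(n : ℝ))).sub
    ((hasDerivAt_id x).mul (hasDerivAt_hermiteFun n x))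
  refine h.congr_deriv ?_
  have h2 : √2 * √2 = (2 : ℝ) := Real.mul_self_sqrt (by norm_num)
  have e1 := mul_add_hermiteDeriv n x
  simp only [id]
  cases n with
  | zero =>
    simp at e1 ⊢
    linear_combination (-x) * e1
  | succ k =>
    have hk : √((k : ℝ) + 1) * √((k : ℝ) + 1) = (k : ℝ) + 1 :=
      Real.mul_self_sqrt (by positivity)
    have e2 := mul_sub_hermiteDeriv k x
    rw [Nat.add_sub_cancel] at *
    push_cast at *
    linear_combination (-(√2 * √((k : ℝ) + 1))) * e2 - x * e1 -
      (2 * hermiteFun (k + 1) x) * hk -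
      (√((k : ℝ) + 1) * √((k : ℝ) + 1) * hermiteFun (k + 1) x) * h2

/-- The Wronskian `D = h_m h_n' - h_m' h_n` has derivative `2(m-n) h_m h_n`, because the `x²` terms
of the two oscillator equations cancel. The sign function splits the integral at `0`. -/
theorem sub_mul_signOverlap (m n : ℕ) :
    ((m : ℝ) - n) * signOverlap m n =
      hermiteDeriv m 0 * hermiteFun n 0 - hermiteFun m 0 * hermiteDeriv n 0 := by
  set D : ℝ → ℝ := fun x => hermiteFun m x * hermiteDeriv n x - hermiteDeriv m x * hermiteFun n x
    with hD
  set f : ℝ → ℝ := fun x => hermiteFun m x * hermiteFun n x with hf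
  have hfi : Integrable f := integrable_hermiteFun_mul m n
  have hderiv : ∀ x, HasDerivAt D (2 * ((m : ℝ) - n) * f x) x := by
    intro x
    refine (((hasDerivAt_hermiteFun m x).mul (hasDerivAt_hermiteDeriv n x)).sub
      ((hasDerivAt_hermiteDeriv m x).mul (hasDerivAt_hermiteFun n x))).congr_deriv ?_
    simp only [hf]
    ring
  have hDi : Integrable D := by
    refine (integrable_hermiteFun_mul_hermiteDeriv m n).sub
      ((integrable_hermiteFun_mul_hermiteDeriv n m).congr (Filter.Eventually.of_forall fun x => ?_))
    simp only
    ring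
  have hgi : Integrable (fun x => 2 * ((m : ℝ) - n) * f x) := hfi.const_mul _
  -- `D` and `D'` are integrable, so `D` vanishes at both ends. The half-line integrals of `D'` are
  -- `-D(0)` and `D(0)`, and the sign makes them add.
  have htop := tendsto_zero_of_hasDerivAt_of_integrableOn_Ioi (a := 0) (fun x _ => hderiv x)
    hgi.integrableOn hDi.integrableOn
  have hbot := tendsto_zero_of_hasDerivAt_of_integrableOn_Iic (a := 0) (fun x _ => hderiv x)
    hgi.integrableOn hDi.integrableOn
  have h1 := integral_Ioi_of_hasDerivAt_of_tendsto' (a := 0) (fun x _ => hderiv x)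
    hgi.integrableOn htop
  have h2 := integral_Iic_of_hasDerivAt_of_tendsto' (a := 0) (fun x _ => hderiv x)
    hgi.integrableOn hbot
  rw [integral_const_mul] at h1 h2
  have hs : signOverlap m n = -(∫ x in Set.Iic 0, f x) + ∫ x in Set.Ioi 0, f x := by
    have hi := integrable_sign_mul m n
    rw [signOverlap, ← intervalIntegral.integral_Iic_add_Ioi (b := 0) hi.integrableOn
      hi.integrableOn, integral_Iic_eq_integral_Iio, integral_Iic_eq_integral_Iio, ← integral_neg]
    congr 1
    · refine setIntegral_congr_fun measurableSet_Iio fun x hx => ?_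
      simp only [Real.sign_of_neg (Set.mem_Iio.1 hx), hf]
      ring
    · refine setIntegral_congr_fun measurableSet_Ioi fun x hx => ?_
      simp only [Real.sign_of_pos (Set.mem_Ioi.1 hx), hf]
      ring
  rw [hs]
  simp only [hD] at h1 h2
  linear_combination h1 / 2 - h2 / 2

theorem hermiteFun_add_two_zero (n : ℕ) :
    √((n : ℝ) + 2) * hermiteFun (n + 2) 0 = -(√((n : ℝ) + 1) * hermiteFun n 0) := by
  have h := hermiteFun_succ (n + 1) 0
  rw [Nat.add_sub_cancel] at h
  push_cast at h
  rw [add_assoc, one_add_one_eq_two] at h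
  linear_combination h

/-- Under the convention `Γ = 0` at poles this needs only `s ≠ 0`, so the poles require no separate
treatment. -/
theorem inv_Gamma_eq {s : ℝ} (hs : s ≠ 0) : (Real.Gamma s)⁻¹ = s * (Real.Gamma (s + 1))⁻¹ := by
  rw [Real.Gamma_add_one hs, mul_inv, mul_inv_cancel_left₀ hs]

/-- Both sides obey the same two-step recursion: `hermiteFun_add_two_zero` on the left, the
functional equation of `Γ` on the right. -/
theorem hermiteFun_zero_right (n : ℕ) :
    hermiteFun n 0 = √2 ^ n * √Real.pi * (Real.Gamma ((1 - (n : ℝ)) / 2))⁻¹ /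
      √((n.factorial : ℝ) * √Real.pi) := by
  induction n using Nat.twoStepInduction with
  | zero =>
    have hpi : √Real.pi ≠ 0 := (Real.sqrt_pos.2 Real.pi_pos).ne'
    have : Real.Gamma (2⁻¹ : ℝ) = √Real.pi := by
      rw [← Real.Gamma_one_half_eq]
      norm_num
    simp [hermiteFun, this, hpi]
  -- Here the argument of `Γ` is the pole `0`, and the default value `0` matches the odd function
  -- `h_1` at the origin.
  | one => simp [hermiteFun, Polynomial.hermite_succ]
  | more n ih _ =>
    have h2 : √2 * √2 = (2 : ℝ) := Real.mul_self_sqrt (by norm_num)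
    have hn1 : √((n : ℝ) + 1) * √((n : ℝ) + 1) = (n : ℝ) + 1 := Real.mul_self_sqrt (by positivity)
    have hp := sqrt_factorial_mul_pos n
    have p1 : 0 < √((n : ℝ) + 1) := by positivity
    have p2 : 0 < √((n : ℝ) + 2) := by positivity
    have hs : (1 - ((n + 2 : ℕ) : ℝ)) / 2 ≠ 0 := by
      push_cast
      have : (0 : ℝ) ≤ n := by positivity
      intro h
      linarith
    have hG := inv_Gamma_eq hs
    rw [show (1 - ((n + 2 : ℕ) : ℝ)) / 2 + 1 = (1 - (n : ℝ)) / 2 by push_cast; ring] at hG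
    have hf : √(((n + 2).factorial : ℝ) * √Real.pi) =
        √((n : ℝ) + 2) * (√((n : ℝ) + 1) * √((n.factorial : ℝ) * √Real.pi)) := by
      rw [sqrt_factorial_succ_mul, sqrt_factorial_succ_mul]
      push_cast
      ring_nf
    rw [← mul_right_inj' p2.ne', hermiteFun_add_two_zero, ih, hG, hf]
    push_cast
    generalize (Real.Gamma ((1 - (n : ℝ)) / 2))⁻¹ = G
    field_simp
    linear_combination (-2 * √2 ^ n * G) * hn1 + (√2 ^ n * G * ((n : ℝ) + 1)) * h2

/-- `h_n'(0) = √(2n) h_{n-1}(0)`, and one step of the functional equation takes `1 - n/2` to `-n/2`.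
For `n = 0` both sides vanish, again through the convention at the pole. -/
theorem hermiteDeriv_zero_right (n : ℕ) :
    hermiteDeriv n 0 = -(2 * √2 ^ n * √Real.pi * (Real.Gamma (-(n : ℝ) / 2))⁻¹ /
      √((n.factorial : ℝ) * √Real.pi)) := by
  cases n with
  | zero => simp [hermiteDeriv]
  | succ k =>
    have hn1 : √((k : ℝ) + 1) * √((k : ℝ) + 1) = (k : ℝ) + 1 := Real.mul_self_sqrt (by positivity)
    have hp := sqrt_factorial_mul_pos k
    have p1 : 0 < √((k : ℝ) + 1) := by positivity
    have hs : -((k + 1 : ℕ) : ℝ) / 2 ≠ 0 := by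
      push_cast
      have : (0 : ℝ) ≤ k := by positivity
      intro h
      linarith
    have hG := inv_Gamma_eq hs
    rw [show -((k + 1 : ℕ) : ℝ) / 2 + 1 = (1 - (k : ℝ)) / 2 by push_cast; ring] at hG
    rw [hermiteDeriv, Nat.add_sub_cancel, hermiteFun_zero_right k, hG, sqrt_factorial_succ_mul]
    push_cast
    generalize (Real.Gamma ((1 - (k : ℝ)) / 2))⁻¹ = G
    field_simp
    linear_combination (√2 * √2 ^ k * √Real.pi * G) * hn1

/-- Squaring removes the overall sign and the square roots of the normalizations. The factor `2` on
the left is the one from folding the double sum. -/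
theorem signOverlap_sq {m n : ℕ} (h : m ≠ n) :
    2 * signOverlap m n ^ 2 = (2 : ℝ) ^ (m + n + 3) * Real.pi * (gammaF m n - gammaF n m) ^ 2 /
      (((m : ℝ) - n) ^ 2 * m.factorial * n.factorial) := by
  have hmn : (m : ℝ) - n ≠ 0 := sub_ne_zero.2 (by exact_mod_cast h)
  have hpi := Real.pi_pos
  have hsp : √Real.pi ^ 2 = Real.pi := Real.sq_sqrt hpi.le
  have hm0 : (m.factorial : ℝ) ≠ 0 := by exact_mod_cast m.factorial_ne_zero
  have hn0 : (n.factorial : ℝ) ≠ 0 := by exact_mod_cast n.factorial_ne_zero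
  have hA : √((m.factorial : ℝ) * √Real.pi) ^ 2 = m.factorial * √Real.pi :=
    Real.sq_sqrt (by positivity)
  have hB : √((n.factorial : ℝ) * √Real.pi) ^ 2 = n.factorial * √Real.pi :=
    Real.sq_sqrt (by positivity)
  have h2 : ∀ k : ℕ, (√2 ^ k) ^ 2 = (2 : ℝ) ^ k := fun k => by
    rw [← pow_mul, mul_comm, pow_mul, Real.sq_sqrt (by norm_num)]
  have key : ((m : ℝ) - n) * signOverlap m n = -(2 * √2 ^ m * √2 ^ n * √Real.pi ^ 2 *
      (gammaF m n - gammaF n m) /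
        (√((m.factorial : ℝ) * √Real.pi) * √((n.factorial : ℝ) * √Real.pi))) := by
    rw [sub_mul_signOverlap, hermiteDeriv_zero_right, hermiteDeriv_zero_right,
      hermiteFun_zero_right, hermiteFun_zero_right, gammaF, gammaF, mul_inv, mul_inv]
    ring
  have key2 := congrArg (fun t => t ^ 2) key
  simp only [neg_sq, div_pow, mul_pow, hA, hB, h2, hsp] at key2
  have hd : ((m.factorial : ℝ) * √Real.pi) * (n.factorial * √Real.pi) =
      m.factorial * n.factorial * Real.pi := by
    linear_combination ((m.factorial : ℝ) * n.factorial) * hsp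
  rw [hd] at key2
  rw [eq_div_iff (by positivity)]
  rw [eq_div_iff (by positivity)] at key2
  rw [← mul_left_inj' hpi.ne']
  linear_combination 2 * key2

end

end BitCorr

/-! ### The main theorem -/

theorem mainTheorem8 (r T : ℝ) (hr : 0 ≤ r) (hT0 : 0 ≤ T) (hT1 : T ≤ 1) :
    -- the series of the state converges to a unit vector
    (HasSum (fun n : ℕ => (BitCorr.psCoeff (Real.tanh r) T n : ℂ) • BitCorr.ket n n)
        (BitCorr.psState r T) ∧
      ‖BitCorr.psState r T‖ = 1) ∧
    -- `Q` is well defined and is the sum of the double series over `0 ≤ m < n`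
    (Integrable (fun ξ : ℝ × ℝ × ℝ × ℝ =>
        BitCorr.wigner (BitCorr.psState r T) ξ.1 ξ.2.1 ξ.2.2.1 ξ.2.2.2) ∧
      IsLUB (Set.range fun a : ℝ × ℝ => |BitCorr.signCorr (BitCorr.psState r T) a.1 a.2|)
        (BitCorr.bitCorr (BitCorr.psState r T)) ∧
      HasSum (fun p : {p : ℕ × ℕ // p.1 < p.2} =>
          (2 : ℝ) ^ (p.1.1 + p.1.2 + 3) * Real.pi *
              (BitCorr.gammaF p.1.1 p.1.2 - BitCorr.gammaF p.1.2 p.1.1) ^ 2 *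
              BitCorr.psCoeff (Real.tanh r) T p.1.1 * BitCorr.psCoeff (Real.tanh r) T p.1.2 /
            (((p.1.1 : ℝ) - (p.1.2 : ℝ)) ^ 2 *
              (p.1.1.factorial : ℝ) * (p.1.2.factorial : ℝ)))
        (BitCorr.bitCorr (BitCorr.psState r T))) ∧
    -- the partial transpose exists, is of trace class, and the negativity has the closed form
    (BitCorr.IsPartialTranspose (BitCorr.density (BitCorr.psState r T))
        (BitCorr.partialTranspose (BitCorr.density (BitCorr.psState r T))) ∧
      BitCorr.traceNorm (BitCorr.partialTranspose
        (BitCorr.density (BitCorr.psState r T))) ≠ ⊤ ∧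
      BitCorr.negativity (BitCorr.density (BitCorr.psState r T)) =
        2 / (1 - T * Real.tanh r) - 1 / (1 + T ^ 2 * Real.tanh r ^ 2) - 1) := by
  have ht0 : 0 ≤ Real.tanh r := by
    rw [Real.tanh_eq_sinh_div_cosh]
    exact div_nonneg (Real.sinh_nonneg_iff.2 hr) (Real.cosh_pos r).le
  -- The hypotheses on `r` and `T` enter only through `0 ≤ TΛ < 1`.
  have h0 : 0 ≤ T * Real.tanh r := mul_nonneg hT0 ht0
  have h1 : T * Real.tanh r < 1 :=
    (mul_le_of_le_one_left ht0 hT1).trans_lt (Real.tanh_lt_one r)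
  refine ⟨⟨BitCorr.hasSum_psState h0 h1, BitCorr.norm_psState h0 h1⟩,
    ⟨BitCorr.integrable_wigner h0 h1, ?_, ?_⟩, ?_, ?_, BitCorr.negativity_psState h0 h1⟩
  · rw [BitCorr.bitCorr_eq h0 h1]
    exact BitCorr.isLUB_abs_signCorr h0 h1
  · refine (BitCorr.hasSum_bitCorr h0 h1).congr_fun fun p => ?_
    have h := BitCorr.signOverlap_sq p.2.ne
    rw [BitCorr.psCoeff₂]
    linear_combination (-(BitCorr.psCoeff (Real.tanh r) T p.1.1 *
      BitCorr.psCoeff (Real.tanh r) T p.1.2)) * h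
  · rw [BitCorr.partialTranspose_psState h0 h1]
    exact BitCorr.isPartialTranspose_psSwap h0 h1
  · rw [BitCorr.partialTranspose_psState h0 h1, BitCorr.traceNorm_psSwap h0 h1]
    exact ENNReal.ofReal_ne_top
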